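/- Let $\Omega\subset\mathbb R^2$ be a bounded open set with $0\in\Omega$, let $F>0$, and let $h_0:\overline\Omega\to[0,\infty)$ satisfy $h_0\in C^1(\overline\Omega)$ (that is, $h_0$ is continuous on $\overline\Omega$, differentiable in $\Omega$, and $\nabla h_0$ extends continuously to $\overline\Omega$) and $\min_\Omega h_0=h_0(0)=0$. Let $K=\{\varphi\in H^1_0(\Omega):\varphi\ge 0\}$. Assume that one of the following holds. (I) Line contact, with $\alpha>1$: for $x\in\Omega$, $h_0(x)=0$ if $x_1=0$ and $h_0(x)>0$ if $x_1\neq0$; and there are an open neighbourhood $W\subset\Omega$ of $0$ and a function $h_1\in C^1(W)$, $h_1>0$, with $h_0(x)=|x_1|^\alpha h_1(x)$ for $x\in W$. (II) Point contact, with $\alpha>\frac32$: $h_0(0)=0$ and $h_0(x)>0$ for $x\in\Omega\setminus\{0\}$; and there are an open neighbourhood $W\subset\Omega$ of $0$ and a function $h_1\in C^1(W)$, $h_1>0$, with $h_0(x)=|x|^\alpha h_1(x)$ for $x\in W$, where $|\cdot|$ is the Euclidean norm. Then for all $\beta>0$ and $\gamma\in\mathbb R$ there is a unique $q=q_{\beta,\gamma}\in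 K$ with $$\int_\Omega (h_0+\beta)^3\,\nabla q\cdot\nabla(\varphi-q)\,dx\;\ge\;\int_\Omega h_0\,\frac{\partial}{\partial x_1}(\varphi-q)\,dx-\gamma\int_\Omega(\varphi-q)\,dx\qquad\text{for all }\varphi\in K,$$ so that $G(\beta,\gamma):=\int_\Omega q_{\beta,\gamma}\,dx-F$ is well defined on $(0,\infty)\times\mathbb R$; and there exists $\bar\eta>0$ with $G(\bar\eta,0)=0$, i.e. a stationary solution of the equation $\eta''=G(\eta,\eta')$. -/

import Mathlib

open MeasureTheory TopologicalSpace
open scoped ContDiff Distributions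

noncomputable section

/-- The Euclidean plane; `x 0` and `x 1` are the two coordinates of a point. -/
abbrev Plane : Type := EuclideanSpace ℝ (Fin 2)

/-- Pairs of classes `(u, v)` in `L²(Ω; ℝ) × L²(Ω; ℝ²)`, with its Hilbert space structure. -/
abbrev L2Pair (Ω : Opens Plane) : Type :=
  WithLp 2 (Lp ℝ 2 (volume.restrict (Ω : Set Plane)) ×
    Lp Plane 2 (volume.restrict (Ω : Set Plane)))

theorem gradient_testFunction_add {Ω : Opens Plane} (φ ψ : 𝓓(Ω, ℝ)) (x : Plane) :
    gradient (φ + ψ : 𝓓(Ω, ℝ)) x = gradient φ x + gradient ψ x := by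
  have h1 : DifferentiableAt ℝ φ x := φ.contDiff.differentiable (by simp) x
  have h2 : DifferentiableAt ℝ ψ x := ψ.contDiff.differentiable (by simp) x
  have e : ((φ + ψ : 𝓓(Ω, ℝ)) : Plane → ℝ) = (φ : Plane → ℝ) + ψ := by
    ext y; simp
  rw [e, gradient, fderiv_add h1 h2, map_add]; rfl

theorem gradient_testFunction_smul {Ω : Opens Plane} (c : ℝ) (φ : 𝓓(Ω, ℝ)) (x : Plane) :
    gradient (c • φ : 𝓓(Ω, ℝ)) x = c • gradient φ x := by
  have h1 : DifferentiableAt ℝ φ x := φ.contDiff.differentiable (by simp) x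
  have e : ((c • φ : 𝓓(Ω, ℝ)) : Plane → ℝ) = c • (φ : Plane → ℝ) := by
    ext y; simp
  rw [e, gradient, fderiv_const_smul h1]; simp [gradient]

theorem gradient_testFunction_continuous {Ω : Opens Plane} (φ : 𝓓(Ω, ℝ)) :
    Continuous (gradient φ) := by
  have h := φ.contDiff.continuous_fderiv (by simp)
  exact (InnerProductSpace.toDual ℝ Plane).symm.continuous.comp h

theorem gradient_testFunction_hasCompactSupport {Ω : Opens Plane} (φ : 𝓓(Ω, ℝ)) :
    HasCompactSupport (gradient φ) := by
  have h := φ.hasCompactSupport.fderiv (𝕜 := ℝ)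
  exact h.comp_left (g := (InnerProductSpace.toDual ℝ Plane).symm) (map_zero _)

theorem integrable_smul_gradient {Ω : Opens Plane} (p : L2Pair Ω) (φ : 𝓓(Ω, ℝ)) :
    Integrable (fun x => p.fst x • gradient φ x) (volume.restrict (Ω : Set Plane)) := by
  have h : MemLp (gradient φ) 2 (volume.restrict (Ω : Set Plane)) :=
    (gradient_testFunction_continuous φ).memLp_of_hasCompactSupport
      (gradient_testFunction_hasCompactSupport φ)
  exact memLp_one_iff_integrable.1 (h.smul (Lp.memLp p.fst))

theorem integrable_testFunction_smul {Ω : Opens Plane} (p : L2Pair Ω) (φ : 𝓓(Ω, ℝ)) :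
    Integrable (fun x => φ x • p.snd x) (volume.restrict (Ω : Set Plane)) := by
  have h : MemLp φ 2 (volume.restrict (Ω : Set Plane)) :=
    φ.continuous.memLp_of_hasCompactSupport φ.hasCompactSupport
  exact memLp_one_iff_integrable.1 ((Lp.memLp p.snd).smul h)

/-- The Sobolev space `H¹(Ω)`: a function `u ∈ L²(Ω)`, recorded together with its weak gradient
`v ∈ L²(Ω; ℝ²)`, as a subspace of `L²(Ω) × L²(Ω; ℝ²)` (the norm is the `H¹` norm). -/
def SobolevH1 (Ω : Opens Plane) : Submodule ℝ (L2Pair Ω) where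
  carrier := {p | ∀ φ : 𝓓(Ω, ℝ),
    ∫ x in (Ω : Set Plane), p.fst x • gradient φ x = - ∫ x in (Ω : Set Plane), φ x • p.snd x}
  add_mem' := by
    intro p q hp hq φ
    have e1 : (fun x => (p + q).fst x • gradient φ x) =ᵐ[volume.restrict (Ω : Set Plane)]
        fun x => p.fst x • gradient φ x + q.fst x • gradient φ x := by
      filter_upwards [Lp.coeFn_add p.fst q.fst] with x hx
      rw [WithLp.add_fst, hx, Pi.add_apply, add_smul]
    have e2 : (fun x => φ x • (p + q).snd x) =ᵐ[volume.restrict (Ω : Set Plane)]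
        fun x => φ x • p.snd x + φ x • q.snd x := by
      filter_upwards [Lp.coeFn_add p.snd q.snd] with x hx
      rw [WithLp.add_snd, hx, Pi.add_apply, smul_add]
    rw [integral_congr_ae e1, integral_congr_ae e2,
      integral_add (integrable_smul_gradient p φ) (integrable_smul_gradient q φ),
      integral_add (integrable_testFunction_smul p φ) (integrable_testFunction_smul q φ),
      hp φ, hq φ, neg_add]
  zero_mem' := by
    intro φ
    have e1 : (fun x => (0 : L2Pair Ω).fst x • gradient φ x)
        =ᵐ[volume.restrict (Ω : Set Plane)] fun _ => (0 : Plane) := by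
      filter_upwards [Lp.coeFn_zero ℝ 2 (volume.restrict (Ω : Set Plane))] with x hx
      rw [WithLp.zero_fst, hx, Pi.zero_apply, zero_smul]
    have e2 : (fun x => φ x • (0 : L2Pair Ω).snd x)
        =ᵐ[volume.restrict (Ω : Set Plane)] fun _ => (0 : Plane) := by
      filter_upwards [Lp.coeFn_zero Plane 2 (volume.restrict (Ω : Set Plane))] with x hx
      rw [WithLp.zero_snd, hx, Pi.zero_apply, smul_zero]
    rw [integral_congr_ae e1, integral_congr_ae e2]
    simp
  smul_mem' := by
    intro c p hp φ
    have e1 : (fun x => (c • p).fst x • gradient φ x) =ᵐ[volume.restrict (Ω : Set Plane)]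
        fun x => c • (p.fst x • gradient φ x) := by
      filter_upwards [Lp.coeFn_smul c p.fst] with x hx
      rw [WithLp.smul_fst, hx, Pi.smul_apply, smul_assoc]
    have e2 : (fun x => φ x • (c • p).snd x) =ᵐ[volume.restrict (Ω : Set Plane)]
        fun x => c • (φ x • p.snd x) := by
      filter_upwards [Lp.coeFn_smul c p.snd] with x hx
      rw [WithLp.smul_snd, hx, Pi.smul_apply, smul_comm]
    rw [integral_congr_ae e1, integral_congr_ae e2, integral_smul, integral_smul, hp φ, smul_neg]

/-- The subspace of all pairs `(φ, ∇φ)` with `φ ∈ C_c^∞(Ω)`. -/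
def testGraph (Ω : Opens Plane) : Submodule ℝ (L2Pair Ω) where
  carrier := {p | ∃ φ : 𝓓(Ω, ℝ),
    p.fst =ᵐ[volume.restrict (Ω : Set Plane)] φ ∧
    p.snd =ᵐ[volume.restrict (Ω : Set Plane)] gradient φ}
  add_mem' := by
    rintro p q ⟨φ, h1, h2⟩ ⟨ψ, h3, h4⟩
    refine ⟨φ + ψ, ?_, ?_⟩
    · filter_upwards [Lp.coeFn_add p.fst q.fst, h1, h3] with x hx a b
      rw [WithLp.add_fst, hx, Pi.add_apply, a, b]; simp
    · filter_upwards [Lp.coeFn_add p.snd q.snd, h2, h4] with x hx a b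
      rw [WithLp.add_snd, hx, Pi.add_apply, a, b, gradient_testFunction_add]
  zero_mem' := by
    refine ⟨0, ?_, ?_⟩
    · filter_upwards [Lp.coeFn_zero ℝ 2 (volume.restrict (Ω : Set Plane))] with x hx
      rw [WithLp.zero_fst, hx]; simp
    · filter_upwards [Lp.coeFn_zero Plane 2 (volume.restrict (Ω : Set Plane))] with x hx
      have h := gradient_testFunction_smul (0 : ℝ) (0 : 𝓓(Ω, ℝ)) x
      rw [zero_smul, zero_smul] at h
      rw [WithLp.zero_snd, hx, h, Pi.zero_apply]
  smul_mem' := by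
    rintro c p ⟨φ, h1, h2⟩
    refine ⟨c • φ, ?_, ?_⟩
    · filter_upwards [Lp.coeFn_smul c p.fst, h1] with x hx a
      rw [WithLp.smul_fst, hx, Pi.smul_apply, a]; simp
    · filter_upwards [Lp.coeFn_smul c p.snd, h2] with x hx a
      rw [WithLp.smul_snd, hx, Pi.smul_apply, a, gradient_testFunction_smul]

/-- `H¹₀(Ω)`: the functions of `H¹(Ω)` that are limits, in the `H¹` norm, of test functions. -/
def SobolevH10 (Ω : Opens Plane) : Submodule ℝ (L2Pair Ω) :=
  SobolevH1 Ω ⊓ (testGraph Ω).topologicalClosure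

/-- The cone `K = {φ ∈ H¹₀(Ω) : φ ≥ 0}`. -/
def admissiblePressures (Ω : Opens Plane) : Set (L2Pair Ω) :=
  {p | p ∈ SobolevH10 Ω ∧ ∀ᵐ x ∂(volume.restrict (Ω : Set Plane)), 0 ≤ p.fst x}

/-- `q ∈ K` solves the Reynolds variational inequality
`∫ (h₀ + β)³ ∇q · ∇(φ - q) ≥ ∫ h₀ ∂₁(φ - q) - γ ∫ (φ - q)` for all `φ ∈ K`. -/
def IsReynoldsSolution (Ω : Opens Plane) (h₀ : Plane → ℝ) (β γ : ℝ) (q : L2Pair Ω) : Prop :=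
  q ∈ admissiblePressures Ω ∧ ∀ φ ∈ admissiblePressures Ω,
    (∫ x in (Ω : Set Plane), (h₀ x + β) ^ 3 * inner ℝ (q.snd x) (φ.snd x - q.snd x)) ≥
      (∫ x in (Ω : Set Plane), h₀ x * (φ.snd x - q.snd x) 0) -
        γ * ∫ x in (Ω : Set Plane), (φ.fst x - q.fst x)

/-- The solution of the Reynolds variational inequality (an arbitrary element of the space when
there is none). -/
def reynoldsPressure (Ω : Opens Plane) (h₀ : Plane → ℝ) (β γ : ℝ) : L2Pair Ω :=
  Classical.epsilon (IsReynoldsSolution Ω h₀ β γ)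

/-- `G(β, γ) = ∫_Ω q dx - F`, the total vertical force on the slider. -/
def reynoldsG (Ω : Opens Plane) (h₀ : Plane → ℝ) (F β γ : ℝ) : ℝ :=
  (∫ x in (Ω : Set Plane), (reynoldsPressure Ω h₀ β γ).fst x) - F

/-- `h₀ ∈ C¹(Ω̄)`: continuous on the closure, differentiable in `Ω`, and the derivative extends
continuously to the closure. -/
def IsC1UpToBoundary (Ω : Opens Plane) (h₀ : Plane → ℝ) : Prop :=
  ContinuousOn h₀ (closure (Ω : Set Plane)) ∧ DifferentiableOn ℝ h₀ (Ω : Set Plane) ∧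
    ∃ g : Plane → Plane →L[ℝ] ℝ, ContinuousOn g (closure (Ω : Set Plane)) ∧
      ∀ x ∈ Ω, fderiv ℝ h₀ x = g x

/-- Line contact: `h₀` vanishes exactly on `{x₁ = 0}`, and `h₀ = |x₁|^α h₁` near `0` with `h₁`
of class `C¹` and positive. -/
def IsLineContact (Ω : Opens Plane) (h₀ : Plane → ℝ) (α : ℝ) : Prop :=
  (∀ x ∈ Ω, x 0 = 0 → h₀ x = 0) ∧ (∀ x ∈ Ω, x 0 ≠ 0 → 0 < h₀ x) ∧
    ∃ (W : Opens Plane) (h₁ : Plane → ℝ), 0 ∈ W ∧ W ≤ Ω ∧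
      ContDiffOn ℝ 1 h₁ (W : Set Plane) ∧ (∀ x ∈ W, 0 < h₁ x) ∧
      ∀ x ∈ W, h₀ x = |x 0| ^ α * h₁ x

/-- Point contact: `h₀` vanishes exactly at `0`, and `h₀ = |x|^α h₁` near `0` with `h₁`
of class `C¹` and positive. -/
def IsPointContact (Ω : Opens Plane) (h₀ : Plane → ℝ) (α : ℝ) : Prop :=
  h₀ 0 = 0 ∧ (∀ x ∈ Ω, x ≠ 0 → 0 < h₀ x) ∧
    ∃ (W : Opens Plane) (h₁ : Plane → ℝ), 0 ∈ W ∧ W ≤ Ω ∧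
      ContDiffOn ℝ 1 h₁ (W : Set Plane) ∧ (∀ x ∈ W, 0 < h₁ x) ∧
      ∀ x ∈ W, h₀ x = ‖x‖ ^ α * h₁ x

end

/-! For `β > 0` the form `∫ (h₀ + β)³ ∇p · ∇q` is bounded, and by Poincaré's inequality coercive on
`H¹₀` with constant `c β³`, `c` depending only on `Ω`. Lions–Stampacchia on the closed convex cone
`K` then gives existence and uniqueness. The representing operators are norm-continuous in `β`, so
`q` and hence `G(·, 0)` are continuous on `(0, ∞)`; the a priori bound `‖q‖ ≤ C β⁻³` gives `G → -F <
0` as `β → ∞`. By the intermediate value theorem it remains to find one `β` whose load `∫ q` exceeds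
`F`.

That lower bound is a duality argument (`IsReynoldsSolution.neg_integral_le`). Testing with `q + φ`,
`φ ≥ 0` smooth, and integrating by parts gives `-∫ ∂₁h₀ φ ≤ -∫ q div((h₀ + β)³ ∇φ) ≤ C ∫ q`, where
`C` bounds the divergence; the last step uses `q ≥ 0`. No pointwise knowledge of `q` is needed.

Take `φ` a bump on the box `[-2ε, -ε] × [-δ, δ]`, where `h₀` decreases in `x₁`, and `β = ε^α`. There
`h₀ + β` is of order `ε^α` and `-∂₁h₀` of order `ε^(α-1)`, so the left side is at least of order `δ
ε^α`, while `C` is of order `ε^(3α-2)`. Hence `∫ q ≥ κ δ ε^(2-2α)` (`exists_load_constant`,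
`rpow_mul_estimates`). For line contact `δ` stays fixed and the bound blows up when `α > 1`; for
point contact the box must shrink, `δ = ε`, and `ε^(3-2α)` blows up when `α > 3/2`. -/

/-! ### Variational inequalities in a Hilbert space -/

section VariationalInequality

open Filter Topology

variable {E : Type*} [NormedAddCommGroup E] [InnerProductSpace ℝ E]

/-- The metric projection onto a complete convex set, characterised by its variational
inequality. -/
theorem exists_projection_of_complete_convex {K : Set E} (hne : K.Nonempty) (hK : IsComplete K)
    (hconv : Convex ℝ K) (x : E) : ∃ v ∈ K, ∀ w ∈ K, inner ℝ (x - v) (w - v) ≤ 0 := by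
  obtain ⟨v, hv, h⟩ := exists_norm_eq_iInf_of_complete_convex hne hK hconv x
  exact ⟨v, hv, (norm_eq_iInf_iff_real_inner_le_zero hconv hv).1 h⟩

/-- Test each projection's inequality with the other projection, add, and apply Cauchy–Schwarz. -/
theorem norm_projection_sub_le {K : Set E} {x y u v : E} (hu : u ∈ K) (hv : v ∈ K)
    (hxu : ∀ w ∈ K, inner ℝ (x - u) (w - u) ≤ 0) (hyv : ∀ w ∈ K, inner ℝ (y - v) (w - v) ≤ 0) :
    ‖u - v‖ ≤ ‖x - y‖ := by
  have h1 := hxu v hv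
  have h2 := hyv u hu
  have h3 : ‖u - v‖ ^ 2 ≤ inner ℝ (x - y) (u - v) := by
    rw [← real_inner_self_eq_norm_sq]
    have e : inner ℝ (x - y) (u - v) - inner ℝ (u - v) (u - v)
        = -inner ℝ (x - u) (v - u) - inner ℝ (y - v) (u - v) := by
      simp only [inner_sub_left, inner_sub_right]; ring
    linarith
  have h4 := real_inner_le_norm (x - y) (u - v)
  by_contra! h
  nlinarith [norm_nonneg (x - y), norm_nonneg (u - v)]

/-- One step of the relaxation `u ↦ u - ρ (A u - ℓ)` contracts when `A` is bounded and coercive. -/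
theorem norm_sub_smul_sq_le {A : E →L[ℝ] E} {c M ρ : ℝ} (hρ : 0 ≤ ρ) (hM : ‖A‖ ≤ M)
    {w : E} (hw : c * ‖w‖ ^ 2 ≤ inner ℝ (A w) w) :
    ‖w - ρ • A w‖ ^ 2 ≤ (1 - 2 * ρ * c + ρ ^ 2 * M ^ 2) * ‖w‖ ^ 2 := by
  rw [norm_sub_sq_real, norm_smul, real_inner_smul_right, real_inner_comm, mul_pow,
    Real.norm_eq_abs, sq_abs]
  have h1 : ‖A w‖ ^ 2 ≤ M ^ 2 * ‖w‖ ^ 2 := by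
    rw [← mul_pow]
    exact pow_le_pow_left₀ (norm_nonneg _)
      ((A.le_opNorm w).trans (mul_le_mul_of_nonneg_right hM (norm_nonneg _))) 2
  have h2 := mul_le_mul_of_nonneg_left h1 (sq_nonneg ρ)
  have h3 := mul_le_mul_of_nonneg_left hw hρ
  nlinarith

/-- **Lions–Stampacchia**, existence. -/
theorem exists_variational_solution [CompleteSpace E] {K : Set E} (hne : K.Nonempty)
    (hK : IsClosed K) (hconv : Convex ℝ K) (A : E →L[ℝ] E) (l : E) {c : ℝ} (hc : 0 < c)
    (hA : ∀ u ∈ K, ∀ v ∈ K, c * ‖u - v‖ ^ 2 ≤ inner ℝ (A (u - v)) (u - v)) :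
    ∃ u ∈ K, ∀ v ∈ K, 0 ≤ inner ℝ (A u - l) (v - u) := by
  choose P hPK hP using exists_projection_of_complete_convex hne hK.isComplete hconv
  -- Adding `c` makes `M` positive and at least `c`, so that `1 - (c / M) ^ 2` is nonnegative.
  set M : ℝ := ‖A‖ + c with hMdef
  have hMc : c ≤ M := by simp [hMdef]
  have hM0 : 0 < M := hc.trans_le hMc
  -- This step size minimises `1 - 2 * ρ * c + ρ ^ 2 * M ^ 2`.
  set ρ : ℝ := c / M ^ 2 with hρdef
  have hρ : 0 < ρ := by positivity
  have hk : 1 - 2 * ρ * c + ρ ^ 2 * M ^ 2 = 1 - (c / M) ^ 2 := by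
    rw [hρdef]; field_simp; ring
  have hcM : 0 < (c / M) ^ 2 := by positivity
  set k : NNReal := Real.toNNReal (Real.sqrt (1 - (c / M) ^ 2)) with hkdef
  have hk1 : k < 1 := by
    rw [hkdef, Real.toNNReal_lt_one, Real.sqrt_lt' one_pos]
    linarith
  have hkc : (k : ℝ) = Real.sqrt (1 - (c / M) ^ 2) := Real.coe_toNNReal _ (Real.sqrt_nonneg _)
  have hcM1 : (c / M) ^ 2 ≤ 1 :=
    pow_le_one₀ (by positivity) ((div_le_one hM0).2 hMc)
  -- At a fixed point the projection inequality is `ρ` times the variational inequality sought.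
  let T : K → K := fun u => ⟨P (u - ρ • (A u - l)), hPK _⟩
  have hT : LipschitzWith k T := by
    refine LipschitzWith.of_dist_le_mul fun u v => ?_
    have h1 := norm_projection_sub_le (hPK _) (hPK _) (hP ((u : E) - ρ • (A u - l)))
      (hP ((v : E) - ρ • (A v - l)))
    have e : ((u : E) - ρ • (A u - l)) - ((v : E) - ρ • (A v - l))
        = ((u : E) - v) - ρ • A ((u : E) - v) := by
      rw [map_sub]; module
    have h2 := norm_sub_smul_sq_le (M := M) hρ.le (by simp [hMdef, hc.le]) (hA u u.2 v v.2)
    rw [hk] at h2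
    rw [Subtype.dist_eq, Subtype.dist_eq, dist_eq_norm, dist_eq_norm, hkc]
    refine (h1.trans_eq (by rw [e])).trans ?_
    rw [← Real.sqrt_sq (norm_nonneg ((u : E) - v)), ← Real.sqrt_mul (by linarith)]
    exact Real.le_sqrt_of_sq_le h2
  have : CompleteSpace K := hK.completeSpace_coe
  have : Nonempty K := hne.to_subtype
  have hTc : ContractingWith k T := ⟨hk1, hT⟩
  obtain ⟨u, hu⟩ : ∃ u, T u = u := ⟨_, hTc.fixedPoint_isFixedPt⟩
  refine ⟨u, u.2, fun v hv => ?_⟩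
  have h := hP ((u : E) - ρ • (A u - l)) v hv
  have hu' : P ((u : E) - ρ • (A u - l)) = u := congrArg Subtype.val hu
  rw [hu', sub_sub_cancel_left, inner_neg_left, real_inner_smul_left] at h
  by_contra! hlt
  nlinarith

/-- Continuous dependence of solutions of variational inequalities on the operator. -/
theorem norm_variational_solution_sub_le {K : Set E} {A B : E →L[ℝ] E} {l u v : E} {c : ℝ}
    (hA : ∀ u ∈ K, ∀ v ∈ K, c * ‖u - v‖ ^ 2 ≤ inner ℝ (A (u - v)) (u - v))
    (hu : u ∈ K) (hv : v ∈ K) (hAu : ∀ w ∈ K, 0 ≤ inner ℝ (A u - l) (w - u))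
    (hBv : ∀ w ∈ K, 0 ≤ inner ℝ (B v - l) (w - v)) :
    c * ‖u - v‖ ≤ ‖A - B‖ * ‖v‖ := by
  have h1 := hAu v hv
  have h2 := hBv u hu
  have h3 := hA u hu v hv
  -- Each solution is tested with the other; the sum leaves only `(B - A) v` against the coercive
  -- term.
  have e : inner ℝ ((B - A) v) (u - v) - inner ℝ (A (u - v)) (u - v)
      = inner ℝ (A u - l) (v - u) + inner ℝ (B v - l) (u - v) := by
    simp only [inner_sub_left, inner_sub_right, map_sub, sub_apply]; ring
  have h4 := real_inner_le_norm ((B - A) v) (u - v)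
  have h5 : ‖(B - A) v‖ ≤ ‖A - B‖ * ‖v‖ := by
    rw [norm_sub_rev A B]; exact (B - A).le_opNorm v
  rcases (norm_nonneg (u - v)).eq_or_lt with h0 | h0
  · rw [← h0, mul_zero]; positivity
  · have h6 := mul_le_mul_of_nonneg_right h5 h0.le
    exact le_of_mul_le_mul_right (by linarith) h0

/-- A priori bound for a solution when the convex set contains the origin. -/
theorem norm_variational_solution_le {K : Set E} {A : E →L[ℝ] E} {l u : E} {c : ℝ}
    (h0 : (0 : E) ∈ K)
    (hA : ∀ u ∈ K, ∀ v ∈ K, c * ‖u - v‖ ^ 2 ≤ inner ℝ (A (u - v)) (u - v))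
    (hu : u ∈ K) (hAu : ∀ w ∈ K, 0 ≤ inner ℝ (A u - l) (w - u)) :
    c * ‖u‖ ≤ ‖l‖ := by
  have h1 := hAu 0 h0
  have h3 := hA u hu 0 h0
  rw [zero_sub, inner_neg_right, inner_sub_left] at h1
  rw [sub_zero] at h3
  have h4 := real_inner_le_norm l u
  rcases (norm_nonneg u).eq_or_lt with h | h
  · rw [← h, mul_zero]; positivity
  · exact le_of_mul_le_mul_right (by linarith) h

end VariationalInequality

/-! ### Integration by parts, the space `H¹₀` and Poincaré's inequality -/

theorem integral_mul_fderiv_of_hasCompactSupport {f g : Plane → ℝ} (hf : ContDiff ℝ 1 f)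
    (hg : ContDiff ℝ 1 g) (hfc : HasCompactSupport f) (v : Plane) :
    ∫ x, f x * fderiv ℝ g x v = - ∫ x, fderiv ℝ f x v * g x := by
  have hf' : Continuous fun x => fderiv ℝ f x v :=
    (hf.continuous_fderiv one_ne_zero).clm_apply continuous_const
  have hg' : Continuous fun x => fderiv ℝ g x v :=
    (hg.continuous_fderiv one_ne_zero).clm_apply continuous_const
  have hfc' : HasCompactSupport fun x => fderiv ℝ f x v := hfc.fderiv_apply (𝕜 := ℝ) v
  exact integral_mul_fderiv_eq_neg_fderiv_mul_of_integrable
    ((hf'.mul hg.continuous).integrable_of_hasCompactSupport hfc'.mul_right)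
    ((hf.continuous.mul hg').integrable_of_hasCompactSupport hfc.mul_right)
    ((hf.continuous.mul hg.continuous).integrable_of_hasCompactSupport hfc.mul_right)
    (fun x _ => hf.differentiable one_ne_zero x) (fun x _ => hg.differentiable one_ne_zero x)

theorem inner_gradient_eq_fderiv (f : Plane → ℝ) (x v : Plane) :
    inner ℝ (gradient f x) v = fderiv ℝ f x v :=
  InnerProductSpace.toDual_symm_apply

theorem gradient_apply (f : Plane → ℝ) (x : Plane) (i : Fin 2) :
    gradient f x i = fderiv ℝ f x (EuclideanSpace.single i 1) := by
  rw [← inner_gradient_eq_fderiv]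
  rw [EuclideanSpace.inner_single_right]
  simp

section SobolevSpace

variable {Ω : Opens Plane}

theorem setIntegral_eq_integral_of_eq_zero_off {F : Type*} [NormedAddCommGroup F]
    [NormedSpace ℝ F] {f : Plane → F} {s : Set Plane} (h : ∀ x ∉ s, f x = 0) :
    ∫ x in s, f x = ∫ x, f x :=
  setIntegral_eq_integral_of_forall_compl_eq_zero h

theorem testFunction_eq_zero_of_notMem (φ : 𝓓(Ω, ℝ)) {x : Plane} (hx : x ∉ Ω) : φ x = 0 :=
  image_eq_zero_of_notMem_tsupport fun h => hx (φ.tsupport_subset h)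

theorem fderiv_testFunction_eq_zero_of_notMem (φ : 𝓓(Ω, ℝ)) {x : Plane} (hx : x ∉ Ω) :
    fderiv ℝ φ x = 0 :=
  image_eq_zero_of_notMem_tsupport fun h => hx (φ.tsupport_subset (tsupport_fderiv_subset ℝ h))

theorem gradient_testFunction_eq_zero_of_notMem (φ : 𝓓(Ω, ℝ)) {x : Plane} (hx : x ∉ Ω) :
    gradient φ x = 0 := by
  rw [gradient, fderiv_testFunction_eq_zero_of_notMem φ hx, map_zero]

theorem contDiff_one_testFunction (φ : 𝓓(Ω, ℝ)) : ContDiff ℝ 1 φ :=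
  φ.contDiff.of_le (by simp)

theorem memLp_testFunction (φ : 𝓓(Ω, ℝ)) : MemLp φ 2 (volume.restrict (Ω : Set Plane)) :=
  φ.continuous.memLp_of_hasCompactSupport φ.hasCompactSupport

theorem memLp_gradient_testFunction (φ : 𝓓(Ω, ℝ)) :
    MemLp (gradient φ) 2 (volume.restrict (Ω : Set Plane)) :=
  (gradient_testFunction_continuous φ).memLp_of_hasCompactSupport
    (gradient_testFunction_hasCompactSupport φ)

/-- A test function as an element `(φ, ∇φ)` of `L² × L²`. -/
noncomputable def testPair (φ : 𝓓(Ω, ℝ)) : L2Pair Ω :=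
  WithLp.toLp 2 ((memLp_testFunction φ).toLp, (memLp_gradient_testFunction φ).toLp)

theorem testPair_fst (φ : 𝓓(Ω, ℝ)) :
    (testPair φ).fst =ᵐ[volume.restrict (Ω : Set Plane)] φ :=
  (memLp_testFunction φ).coeFn_toLp

theorem testPair_snd (φ : 𝓓(Ω, ℝ)) :
    (testPair φ).snd =ᵐ[volume.restrict (Ω : Set Plane)] gradient φ :=
  (memLp_gradient_testFunction φ).coeFn_toLp

/-- A closed property of pairs holds on `H¹₀` as soon as it holds for test functions. -/
theorem SobolevH10.induction {P : L2Pair Ω → Prop} (hP : IsClosed {p | P p})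
    (h : ∀ φ : 𝓓(Ω, ℝ), P (testPair φ)) {p : L2Pair Ω} (hp : p ∈ SobolevH10 Ω) : P p := by
  have h1 : (testGraph Ω : Set (L2Pair Ω)) ⊆ {p | P p} := by
    rintro q ⟨φ, h1, h2⟩
    have e : q = testPair φ := by
      refine WithLp.ofLp_injective 2 (Prod.ext ?_ ?_)
      · exact Lp.ext (h1.trans (testPair_fst φ).symm)
      · exact Lp.ext (h2.trans (testPair_snd φ).symm)
    rw [e]; exact h φ
  exact closure_minimal h1 hP hp.2

theorem continuous_L2Pair_fst : Continuous fun p : L2Pair Ω => p.fst :=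
  (WithLp.fstL 2 ℝ _ _).continuous

theorem continuous_L2Pair_snd : Continuous fun p : L2Pair Ω => p.snd :=
  (WithLp.sndL 2 ℝ _ _).continuous

theorem integral_smul_gradient_testFunction (φ χ : 𝓓(Ω, ℝ)) :
    ∫ x in (Ω : Set Plane), φ x • gradient χ x = -∫ x in (Ω : Set Plane), χ x • gradient φ x := by
  have hi : ∀ φ χ : 𝓓(Ω, ℝ), Integrable (fun x => φ x • gradient χ x) := fun φ χ =>
    (φ.continuous.smul (gradient_testFunction_continuous χ)).integrable_of_hasCompactSupport
      φ.hasCompactSupport.smul_right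
  have hs : ∀ φ χ : 𝓓(Ω, ℝ), ∫ x in (Ω : Set Plane), φ x • gradient χ x
      = ∫ x, φ x • gradient χ x := fun φ χ =>
    setIntegral_eq_integral_of_eq_zero_off fun x hx => by
      rw [testFunction_eq_zero_of_notMem φ hx, zero_smul]
  rw [hs, hs]
  refine ext_inner_left ℝ fun v => ?_
  rw [inner_neg_right, ← integral_inner (hi φ χ), ← integral_inner (hi χ φ)]
  have h := integral_mul_fderiv_of_hasCompactSupport (contDiff_one_testFunction φ)
    (contDiff_one_testFunction χ) φ.hasCompactSupport v
  simp only [real_inner_comm _ v, real_inner_smul_left, inner_gradient_eq_fderiv]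
  rw [h]
  simp only [mul_comm]

theorem testPair_mem_SobolevH10 (φ : 𝓓(Ω, ℝ)) : testPair φ ∈ SobolevH10 Ω := by
  refine ⟨fun χ => ?_, subset_closure ⟨φ, testPair_fst φ, testPair_snd φ⟩⟩
  have e1 : (fun x => (testPair φ).fst x • gradient χ x) =ᵐ[volume.restrict (Ω : Set Plane)]
      fun x => φ x • gradient χ x := by
    filter_upwards [testPair_fst φ] with x hx; rw [hx]
  have e2 : (fun x => χ x • (testPair φ).snd x) =ᵐ[volume.restrict (Ω : Set Plane)]
      fun x => χ x • gradient φ x := by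
    filter_upwards [testPair_snd φ] with x hx; rw [hx]
  rw [integral_congr_ae e1, integral_congr_ae e2, integral_smul_gradient_testFunction]

/-- Each test function imposes an equality between two continuous `L²` pairings. -/
theorem isClosed_SobolevH1 : IsClosed (SobolevH1 Ω : Set (L2Pair Ω)) := by
  have e : (SobolevH1 Ω : Set (L2Pair Ω)) = ⋂ φ : 𝓓(Ω, ℝ), {p |
      (ContinuousLinearMap.lsmul ℝ ℝ).lpPairing (volume.restrict (Ω : Set Plane)) 2 2
        p.fst (testPair φ).snd =
      -(ContinuousLinearMap.lsmul ℝ ℝ).lpPairing (volume.restrict (Ω : Set Plane)) 2 2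
        (testPair φ).fst p.snd} := by
    ext p
    simp only [Set.mem_iInter, Set.mem_ofPred_eq]
    refine forall_congr' fun φ => ?_
    rw [ContinuousLinearMap.lpPairing_eq_integral, ContinuousLinearMap.lpPairing_eq_integral]
    have e1 : (fun x => p.fst x • gradient φ x) =ᵐ[volume.restrict (Ω : Set Plane)]
        fun x => (ContinuousLinearMap.lsmul ℝ ℝ) (p.fst x) ((testPair φ).snd x) := by
      filter_upwards [testPair_snd φ] with x hx; rw [hx]; rfl
    have e2 : (fun x => φ x • p.snd x) =ᵐ[volume.restrict (Ω : Set Plane)]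
        fun x => (ContinuousLinearMap.lsmul ℝ ℝ) ((testPair φ).fst x) (p.snd x) := by
      filter_upwards [testPair_fst φ] with x hx; rw [hx]; rfl
    rw [integral_congr_ae e1, integral_congr_ae e2]
  rw [e]
  refine isClosed_iInter fun φ => isClosed_eq ?_ ?_
  · exact (ContinuousLinearMap.continuous _).clm_apply continuous_const |>.comp
      continuous_L2Pair_fst
  · exact ((ContinuousLinearMap.continuous _).comp continuous_L2Pair_snd).neg

theorem isClosed_SobolevH10 : IsClosed (SobolevH10 Ω : Set (L2Pair Ω)) :=
  isClosed_SobolevH1.inter (Submodule.isClosed_topologicalClosure _)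

theorem isClosed_admissiblePressures : IsClosed (admissiblePressures Ω) := by
  have e : admissiblePressures Ω = (SobolevH10 Ω : Set (L2Pair Ω)) ∩ {p | 0 ≤ p.fst} := by
    ext p
    exact and_congr Iff.rfl (Lp.coeFn_nonneg p.fst)
  rw [e]
  exact isClosed_SobolevH10.inter (isClosed_le continuous_const continuous_L2Pair_fst)

theorem convex_admissiblePressures : Convex ℝ (admissiblePressures Ω) := by
  rintro p ⟨hp, hp0⟩ q ⟨hq, hq0⟩ a b ha hb -
  refine ⟨add_mem (Submodule.smul_mem _ _ hp) (Submodule.smul_mem _ _ hq), ?_⟩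
  filter_upwards [hp0, hq0, Lp.coeFn_add (a • p.fst) (b • q.fst), Lp.coeFn_smul a p.fst,
    Lp.coeFn_smul b q.fst] with x h1 h2 h3 h4 h5
  rw [WithLp.add_fst, WithLp.smul_fst, WithLp.smul_fst, h3, Pi.add_apply, h4, h5]
  simp only [Pi.smul_apply, smul_eq_mul]
  positivity

theorem zero_mem_admissiblePressures : (0 : L2Pair Ω) ∈ admissiblePressures Ω := by
  refine ⟨zero_mem _, ?_⟩
  filter_upwards [Lp.coeFn_zero ℝ 2 (volume.restrict (Ω : Set Plane))] with x hx
  rw [WithLp.zero_fst, hx, Pi.zero_apply]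

theorem add_mem_admissiblePressures {p q : L2Pair Ω} (hp : p ∈ admissiblePressures Ω)
    (hq : q ∈ admissiblePressures Ω) : p + q ∈ admissiblePressures Ω := by
  refine ⟨add_mem hp.1 hq.1, ?_⟩
  filter_upwards [hp.2, hq.2, Lp.coeFn_add p.fst q.fst] with x h1 h2 h3
  rw [WithLp.add_fst, h3, Pi.add_apply]
  exact add_nonneg h1 h2

theorem testPair_mem_admissiblePressures {φ : 𝓓(Ω, ℝ)} (h : ∀ x, 0 ≤ φ x) :
    testPair φ ∈ admissiblePressures Ω := by
  refine ⟨testPair_mem_SobolevH10 φ, ?_⟩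
  filter_upwards [testPair_fst φ] with x hx
  rw [hx]; exact h x

theorem real_inner_eq_mul (a b : ℝ) : inner ℝ a b = a * b := by simp [mul_comm]

theorem norm_sq_eq_integral {F : Type*} [NormedAddCommGroup F] [InnerProductSpace ℝ F]
    {μ : Measure Plane} (f : Lp F 2 μ) : ‖f‖ ^ 2 = ∫ x, ‖f x‖ ^ 2 ∂μ := by
  rw [← real_inner_self_eq_norm_sq, L2.inner_def]
  simp only [real_inner_self_eq_norm_sq]

theorem contDiff_coord (i : Fin 2) : ContDiff ℝ 1 fun x : Plane => x i :=
  (EuclideanSpace.proj (𝕜 := ℝ) i).contDiff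

theorem fderiv_coord (i : Fin 2) (x v : Plane) : fderiv ℝ (fun x : Plane => x i) x v = v i := by
  have h := ((EuclideanSpace.proj i : Plane →L[ℝ] ℝ).hasFDerivAt (x := x)).fderiv
  exact congrArg (fun l : Plane →L[ℝ] ℝ => l v) h

/-- The start of Poincaré's inequality: write `1 = ∂₁x₁` and integrate by parts. -/
theorem integral_testFunction_sq_eq (φ : 𝓓(Ω, ℝ)) :
    ∫ x, φ x ^ 2 = ∫ x, -(2 * φ x * gradient φ x 0 * x 0) := by
  have hφ := contDiff_one_testFunction φ
  have hc : HasCompactSupport fun x => φ x ^ 2 :=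
    HasCompactSupport.intro φ.hasCompactSupport fun x hx => by
      simp only [image_eq_zero_of_notMem_tsupport hx, zero_pow two_ne_zero]
  have h := integral_mul_fderiv_of_hasCompactSupport (hφ.pow 2) (contDiff_coord 0) hc
    (EuclideanSpace.single 0 1)
  rw [← integral_neg] at h
  refine Eq.trans (integral_congr_ae (.of_forall fun x => ?_))
    (h.trans (integral_congr_ae (.of_forall fun x => ?_)))
  · simp only [fderiv_coord]
    simp
  · have h1 := ((hφ.differentiable one_ne_zero x).hasFDerivAt.pow 2).fderiv
    simp only [gradient_apply]
    rw [h1]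
    simp

/-- Young's inequality, weighted so that the `φ²` term can be absorbed after integration. -/
theorem neg_mul_gradient_mul_coord_le (φ : 𝓓(Ω, ℝ)) {R : ℝ} (hR : ∀ x ∈ Ω, ‖x‖ ≤ R)
    (x : Plane) :
    -(2 * φ x * gradient φ x 0 * x 0) ≤
      1 / 2 * φ x ^ 2 + 2 * R ^ 2 * ‖gradient φ x‖ ^ 2 := by
  by_cases hx : x ∈ Ω
  · have h4 : |gradient φ x 0| ≤ ‖gradient φ x‖ := PiLp.norm_apply_le (gradient φ x) 0
    have h5 : |x 0| ≤ R := (PiLp.norm_apply_le x 0).trans (hR x hx)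
    have h6 : |gradient φ x 0 * x 0| ≤ ‖gradient φ x‖ * R := by
      rw [abs_mul]
      exact mul_le_mul h4 h5 (abs_nonneg _) (norm_nonneg _)
    have h7 : (gradient φ x 0 * x 0) ^ 2 ≤ (‖gradient φ x‖ * R) ^ 2 :=
      sq_le_sq' (abs_le.1 h6).1 (abs_le.1 h6).2
    linarith [sq_nonneg (φ x + 2 * (gradient φ x 0 * x 0))]
  · rw [testFunction_eq_zero_of_notMem φ hx, mul_zero, zero_mul, zero_mul, neg_zero]
    positivity

theorem integral_sq_le_integral_gradient_sq (φ : 𝓓(Ω, ℝ)) {R : ℝ} (hR : ∀ x ∈ Ω, ‖x‖ ≤ R) :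
    ∫ x, φ x ^ 2 ≤ 4 * R ^ 2 * ∫ x, ‖gradient φ x‖ ^ 2 := by
  have hi1 : Integrable fun x => φ x ^ 2 :=
    (φ.continuous.pow 2).integrable_of_hasCompactSupport
      (HasCompactSupport.intro φ.hasCompactSupport fun x hx => by
        show φ x ^ 2 = 0
        rw [image_eq_zero_of_notMem_tsupport hx, zero_pow two_ne_zero])
  have hi2 : Integrable fun x => ‖gradient φ x‖ ^ 2 :=
    ((gradient_testFunction_continuous φ).norm.pow 2).integrable_of_hasCompactSupport
      (HasCompactSupport.intro (gradient_testFunction_hasCompactSupport φ) fun x hx => by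
        show ‖gradient φ x‖ ^ 2 = 0
        rw [image_eq_zero_of_notMem_tsupport hx, norm_zero, zero_pow two_ne_zero])
  have hi3 : Integrable fun x => -(2 * φ x * gradient φ x 0 * x 0) := by
    refine Continuous.integrable_of_hasCompactSupport ?_ ?_
    · exact (((continuous_const.mul φ.continuous).mul
        ((contDiff_coord 0).continuous.comp (gradient_testFunction_continuous φ))).mul
        (contDiff_coord 0).continuous).neg
    · refine HasCompactSupport.intro φ.hasCompactSupport fun x hx => ?_
      rw [image_eq_zero_of_notMem_tsupport hx, mul_zero, zero_mul, zero_mul, neg_zero]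
  have h3 : ∫ x, -(2 * φ x * gradient φ x 0 * x 0) ≤
      ∫ x, (1 / 2 * φ x ^ 2 + 2 * R ^ 2 * ‖gradient φ x‖ ^ 2) :=
    integral_mono hi3 ((hi1.const_mul (1 / 2)).add (hi2.const_mul (2 * R ^ 2)))
      (neg_mul_gradient_mul_coord_le φ hR)
  rw [← integral_testFunction_sq_eq, integral_add (hi1.const_mul _) (hi2.const_mul _),
    integral_const_mul, integral_const_mul] at h3
  linarith

/-- **Poincaré inequality** on `H¹₀` of a bounded open set. -/
theorem SobolevH10.norm_fst_sq_le {R : ℝ} (hR : ∀ x ∈ Ω, ‖x‖ ≤ R) {p : L2Pair Ω}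
    (hp : p ∈ SobolevH10 Ω) : ‖p.fst‖ ^ 2 ≤ 4 * R ^ 2 * ‖p.snd‖ ^ 2 := by
  refine SobolevH10.induction (P := fun p => ‖p.fst‖ ^ 2 ≤ 4 * R ^ 2 * ‖p.snd‖ ^ 2)
    (isClosed_le (by have := continuous_L2Pair_fst (Ω := Ω); fun_prop)
      (by have := continuous_L2Pair_snd (Ω := Ω); fun_prop)) (fun φ => ?_) hp
  have e1 : ‖(testPair φ).fst‖ ^ 2 = ∫ x, φ x ^ 2 := by
    rw [norm_sq_eq_integral, ← setIntegral_eq_integral_of_eq_zero_off (s := (Ω : Set Plane))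
      fun x hx => by rw [testFunction_eq_zero_of_notMem φ hx, zero_pow two_ne_zero]]
    refine integral_congr_ae ((testPair_fst φ).mono fun x hx => ?_)
    simp only [hx, Real.norm_eq_abs, sq_abs]
  have e2 : ‖(testPair φ).snd‖ ^ 2 = ∫ x, ‖gradient φ x‖ ^ 2 := by
    rw [norm_sq_eq_integral, ← setIntegral_eq_integral_of_eq_zero_off (s := (Ω : Set Plane))
      fun x hx => by
        rw [gradient_testFunction_eq_zero_of_notMem φ hx, norm_zero, zero_pow two_ne_zero]]
    refine integral_congr_ae ((testPair_snd φ).mono fun x hx => ?_)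
    simp only [hx]
  rw [e1, e2]
  exact integral_sq_le_integral_gradient_sq φ hR

theorem SobolevH10.norm_sq_le {R : ℝ} (hR : ∀ x ∈ Ω, ‖x‖ ≤ R) {p : L2Pair Ω}
    (hp : p ∈ SobolevH10 Ω) : ‖p‖ ^ 2 ≤ (4 * R ^ 2 + 1) * ‖p.snd‖ ^ 2 := by
  have h := SobolevH10.norm_fst_sq_le hR hp
  rw [WithLp.prod_norm_sq_eq_of_L2]
  linarith

/-- The weak divergence identity for `H¹₀` functions and `C¹` vector fields. -/
theorem SobolevH10.integral_inner_eq {p : L2Pair Ω} (hp : p ∈ SobolevH10 Ω) {X : Plane → Plane}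
    (hX : ContDiff ℝ 1 X) (hc : HasCompactSupport X) :
    ∫ x in (Ω : Set Plane), inner ℝ (p.snd x) (X x) =
      -∫ x in (Ω : Set Plane), p.fst x *
        ∑ i, fderiv ℝ (fun y => X y i) x (EuclideanSpace.single i 1) := by
  set D : Plane → ℝ := fun x => ∑ i, fderiv ℝ (fun y => X y i) x (EuclideanSpace.single i 1)
    with hD
  have hXi : ∀ i, ContDiff ℝ 1 fun y => X y i := fun i => (contDiff_coord i).comp hX
  have hXc : ∀ i, HasCompactSupport fun y => X y i := fun i =>
    hc.comp_left (g := fun y : Plane => y i) rfl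
  have hDcont : Continuous D := continuous_finsetSum _ fun i _ =>
    ((hXi i).continuous_fderiv one_ne_zero).clm_apply continuous_const
  have hDi : ∀ i, HasCompactSupport fun x => fderiv ℝ (fun y => X y i) x
      (EuclideanSpace.single i 1) := fun i => (hXc i).fderiv_apply (𝕜 := ℝ) _
  have hDc : HasCompactSupport D := by
    have e : D = (fun x => fderiv ℝ (fun y => X y 0) x (EuclideanSpace.single 0 1)) +
        fun x => fderiv ℝ (fun y => X y 1) x (EuclideanSpace.single 1 1) := by
      ext x; simp [hD, Fin.sum_univ_two]
    rw [e]; exact (hDi 0).add (hDi 1)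
  have hXL : MemLp X 2 (volume.restrict (Ω : Set Plane)) :=
    hX.continuous.memLp_of_hasCompactSupport hc
  have hDL : MemLp D 2 (volume.restrict (Ω : Set Plane)) :=
    hDcont.memLp_of_hasCompactSupport hDc
  -- As an equality of `L²` inner products the identity is closed in `p`, so it need only be checked
  -- on test functions.
  have key : ∀ p : L2Pair Ω, (∫ x in (Ω : Set Plane), inner ℝ (p.snd x) (X x) =
      -∫ x in (Ω : Set Plane), p.fst x * D x) ↔
      inner ℝ p.snd (MemLp.toLp X hXL) = -inner ℝ p.fst (MemLp.toLp D hDL) := by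
    intro p
    have e1 : inner ℝ p.snd (MemLp.toLp X hXL) =
        ∫ x in (Ω : Set Plane), inner ℝ (p.snd x) (X x) := by
      rw [L2.inner_def]
      refine integral_congr_ae (hXL.coeFn_toLp.mono fun x hx => ?_)
      simp only [hx]
    have e2 : inner ℝ p.fst (MemLp.toLp D hDL) = ∫ x in (Ω : Set Plane), p.fst x * D x := by
      rw [L2.inner_def]
      refine integral_congr_ae (hDL.coeFn_toLp.mono fun x hx => ?_)
      simp only [hx, real_inner_eq_mul]
    rw [e1, e2]
  refine (key p).2 (SobolevH10.induction
    (P := fun p => inner ℝ p.snd (MemLp.toLp X hXL) = -inner ℝ p.fst (MemLp.toLp D hDL))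
    (isClosed_eq (continuous_L2Pair_snd.inner continuous_const)
      (continuous_L2Pair_fst.inner continuous_const).neg) (fun φ => (key _).1 ?_) hp)
  have e2 : ∫ x in (Ω : Set Plane), inner ℝ ((testPair φ).snd x) (X x) =
      ∫ x, inner ℝ (gradient φ x) (X x) := by
    rw [← setIntegral_eq_integral_of_eq_zero_off (s := (Ω : Set Plane)) fun x hx => by
      rw [gradient_testFunction_eq_zero_of_notMem φ hx, inner_zero_left]]
    refine integral_congr_ae ((testPair_snd φ).mono fun x hx => ?_)
    simp only [hx]
  have e3 : ∫ x in (Ω : Set Plane), (testPair φ).fst x * D x = ∫ x, φ x * D x := by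
    rw [← setIntegral_eq_integral_of_eq_zero_off (s := (Ω : Set Plane)) fun x hx => by
      rw [testFunction_eq_zero_of_notMem φ hx, zero_mul]]
    refine integral_congr_ae ((testPair_fst φ).mono fun x hx => ?_)
    simp only [hx]
  rw [e2, e3]
  have hφ := contDiff_one_testFunction φ
  have hi : ∀ i, ∫ x, fderiv ℝ φ x (EuclideanSpace.single i 1) * X x i =
      -∫ x, φ x * fderiv ℝ (fun y => X y i) x (EuclideanSpace.single i 1) := fun i => by
    rw [integral_mul_fderiv_of_hasCompactSupport hφ (hXi i) φ.hasCompactSupport, neg_neg]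
  have hφ' : ∀ i : Fin 2, Continuous fun x =>
      fderiv ℝ φ x (EuclideanSpace.single i 1) := fun i =>
    (hφ.continuous_fderiv one_ne_zero).clm_apply continuous_const
  have e1 : ∀ x, inner ℝ (gradient φ x) (X x) =
      ∑ i, fderiv ℝ φ x (EuclideanSpace.single i 1) * X x i := fun x => by
    rw [PiLp.inner_apply]
    simp only [gradient_apply, real_inner_eq_mul]
  simp only [e1, hD, Finset.mul_sum]
  have i1 : ∀ i ∈ Finset.univ, Integrable fun x =>
      fderiv ℝ φ x (EuclideanSpace.single i 1) * X x i := fun i _ =>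
    ((hφ' i).mul (hXi i).continuous).integrable_of_hasCompactSupport (hXc i).mul_left
  have i2 : ∀ i ∈ Finset.univ, Integrable fun x =>
      φ x * fderiv ℝ (fun y => X y i) x (EuclideanSpace.single i 1) := fun i _ =>
    (hφ.continuous.mul (((hXi i).continuous_fderiv one_ne_zero).clm_apply
      continuous_const)).integrable_of_hasCompactSupport φ.hasCompactSupport.mul_right
  rw [integral_finsetSum _ i1, integral_finsetSum _ i2, ← Finset.sum_neg_distrib]
  exact Finset.sum_congr rfl fun i _ => hi i

end SobolevSpace

/-! ### The Reynolds operator: coercivity, well-posedness, dependence on `β` -/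

section ReynoldsOperator

open Filter Topology

variable {Ω : Opens Plane} {h₀ : Plane → ℝ}

theorem IsC1UpToBoundary.memLp_top (hC1 : IsC1UpToBoundary Ω h₀)
    (hbdd : Bornology.IsBounded (Ω : Set Plane)) :
    MemLp h₀ ⊤ (volume.restrict (Ω : Set Plane)) := by
  obtain ⟨C, hC⟩ := hbdd.isCompact_closure.exists_bound_of_continuousOn hC1.1
  refine memLp_top_of_bound
    ((hC1.1.mono subset_closure).aestronglyMeasurable Ω.isOpen.measurableSet) C ?_
  filter_upwards [ae_restrict_mem Ω.isOpen.measurableSet] with x hx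
  exact hC x (subset_closure hx)

/-- The weights `(h₀ + β)³` as a continuous curve in `L^∞`. -/
theorem exists_continuous_weight (hbdd : Bornology.IsBounded (Ω : Set Plane))
    (hC1 : IsC1UpToBoundary Ω h₀) :
    ∃ W : ℝ → Lp ℝ ⊤ (volume.restrict (Ω : Set Plane)), Continuous W ∧
      ∀ β, W β =ᵐ[volume.restrict (Ω : Set Plane)] fun x => (h₀ x + β) ^ 3 := by
  have m1 := hC1.memLp_top hbdd
  have m2 : MemLp (fun x => h₀ x * h₀ x) ⊤ (volume.restrict (Ω : Set Plane)) := m1.mul m1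
  have m3 : MemLp (fun x => h₀ x * h₀ x * h₀ x) ⊤ (volume.restrict (Ω : Set Plane)) := m1.mul m2
  have m0 : MemLp (fun _ => (1 : ℝ)) ⊤ (volume.restrict (Ω : Set Plane)) := memLp_top_const 1
  -- The expanded cube is a polynomial in `β` with `L^∞` coefficients, which makes continuity
  -- immediate.
  refine ⟨fun β => m3.toLp + (3 * β) • m2.toLp + (3 * β ^ 2) • m1.toLp + β ^ 3 • m0.toLp,
    by fun_prop, fun β => ?_⟩
  filter_upwards [Lp.coeFn_add (m3.toLp + (3 * β) • m2.toLp + (3 * β ^ 2) • m1.toLp)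
      (β ^ 3 • m0.toLp), Lp.coeFn_add (m3.toLp + (3 * β) • m2.toLp) ((3 * β ^ 2) • m1.toLp),
    Lp.coeFn_add m3.toLp ((3 * β) • m2.toLp), Lp.coeFn_smul (3 * β) m2.toLp,
    Lp.coeFn_smul (3 * β ^ 2) m1.toLp, Lp.coeFn_smul (β ^ 3) m0.toLp, m0.coeFn_toLp,
    m1.coeFn_toLp, m2.coeFn_toLp, m3.coeFn_toLp] with x e1 e2 e3 e4 e5 e6 f0 f1 f2 f3
  rw [e1, Pi.add_apply, e2, Pi.add_apply, e3, Pi.add_apply, e4, e5, e6]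
  simp only [Pi.smul_apply, smul_eq_mul, f0, f1, f2, f3]
  ring

/-- The bilinear form of the Reynolds inequality is represented by bounded operators depending
continuously on `β`. -/
theorem exists_reynoldsOperator (hbdd : Bornology.IsBounded (Ω : Set Plane))
    (hC1 : IsC1UpToBoundary Ω h₀) :
    ∃ A : ℝ → L2Pair Ω →L[ℝ] L2Pair Ω, Continuous A ∧ ∀ β p q, inner ℝ (A β p) q =
      ∫ x in (Ω : Set Plane), (h₀ x + β) ^ 3 * inner ℝ (p.snd x) (q.snd x) := by
  obtain ⟨W, hWc, hW⟩ := exists_continuous_weight hbdd hC1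
  let μ : Measure Plane := volume.restrict (Ω : Set Plane)
  let π : L2Pair Ω →L[ℝ] Lp Plane 2 μ := WithLp.sndL 2 ℝ _ _
  let M : Lp ℝ ⊤ μ →L[ℝ] Lp Plane 2 μ →L[ℝ] Lp Plane 2 μ :=
    (ContinuousLinearMap.lsmul ℝ ℝ).holderL μ ⊤ 2 2
  -- Project to the gradient, multiply by the weight, and return by the adjoint.
  refine ⟨fun β => (ContinuousLinearMap.adjoint π).comp ((M (W β)).comp π), ?_, fun β p q => ?_⟩
  · have h1 : Continuous fun β => M (W β) := M.continuous.comp hWc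
    exact continuous_const.clm_comp (h1.clm_comp continuous_const)
  · rw [ContinuousLinearMap.comp_apply, ContinuousLinearMap.adjoint_inner_left, L2.inner_def]
    refine integral_congr_ae ?_
    have h := ContinuousLinearMap.coeFn_holder (r := 2) (ContinuousLinearMap.lsmul ℝ ℝ)
      (W β) (π p)
    filter_upwards [hW β, h] with x h1 h2
    have h3 : (M (W β) (π p)) x = W β x • p.snd x := h2
    rw [ContinuousLinearMap.comp_apply, h3, real_inner_smul_left, h1]
    rfl

theorem memLp_const_one (hbdd : Bornology.IsBounded (Ω : Set Plane)) :
    MemLp (fun _ : Plane => (1 : ℝ)) 2 (volume.restrict (Ω : Set Plane)) := by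
  have : IsFiniteMeasure (volume.restrict (Ω : Set Plane)) :=
    ⟨by simpa using hbdd.measure_lt_top⟩
  exact memLp_const 1

theorem exists_inner_eq_integral_fst (hbdd : Bornology.IsBounded (Ω : Set Plane)) :
    ∃ l : L2Pair Ω, ∀ p, inner ℝ l p = ∫ x in (Ω : Set Plane), p.fst x := by
  have m := memLp_const_one hbdd
  refine ⟨WithLp.toLp 2 (m.toLp, 0), fun p => ?_⟩
  rw [WithLp.prod_inner_apply]
  show inner ℝ m.toLp p.fst + inner ℝ (0 : Lp Plane 2 (volume.restrict (Ω : Set Plane))) p.snd = _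
  rw [inner_zero_left, add_zero, L2.inner_def]
  refine integral_congr_ae (m.coeFn_toLp.mono fun x hx => ?_)
  simp only [hx, real_inner_eq_mul, one_mul]

theorem exists_inner_eq_integral_snd (hbdd : Bornology.IsBounded (Ω : Set Plane))
    (hC1 : IsC1UpToBoundary Ω h₀) :
    ∃ l : L2Pair Ω, ∀ p, inner ℝ l p = ∫ x in (Ω : Set Plane), h₀ x * p.snd x 0 := by
  have m : MemLp (fun x => h₀ x • (EuclideanSpace.single 0 1 : Plane)) 2
      (volume.restrict (Ω : Set Plane)) := by
    have : IsFiniteMeasure (volume.restrict (Ω : Set Plane)) :=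
      ⟨by simpa using hbdd.measure_lt_top⟩
    have h1 : MemLp (fun _ : Plane => (EuclideanSpace.single 0 1 : Plane)) 2
      (volume.restrict (Ω : Set Plane)) := memLp_const _
    exact h1.smul (hC1.memLp_top hbdd)
  refine ⟨WithLp.toLp 2 (0, m.toLp), fun p => ?_⟩
  rw [WithLp.prod_inner_apply]
  show inner ℝ (0 : Lp ℝ 2 (volume.restrict (Ω : Set Plane))) p.fst + inner ℝ m.toLp p.snd = _
  rw [inner_zero_left, zero_add, L2.inner_def]
  refine integral_congr_ae (m.coeFn_toLp.mono fun x hx => ?_)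
  simp only [hx, real_inner_smul_left, EuclideanSpace.inner_single_left]
  simp

/-- The Reynolds inequality in abstract form. -/
theorem isReynoldsSolution_iff {A : L2Pair Ω →L[ℝ] L2Pair Ω} {l₁ l₂ : L2Pair Ω} {β γ : ℝ}
    (hA : ∀ p q, inner ℝ (A p) q =
      ∫ x in (Ω : Set Plane), (h₀ x + β) ^ 3 * inner ℝ (p.snd x) (q.snd x))
    (hl₁ : ∀ p, inner ℝ l₁ p = ∫ x in (Ω : Set Plane), p.fst x)
    (hl₂ : ∀ p, inner ℝ l₂ p = ∫ x in (Ω : Set Plane), h₀ x * p.snd x 0) (q : L2Pair Ω) :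
    IsReynoldsSolution Ω h₀ β γ q ↔ q ∈ admissiblePressures Ω ∧
      ∀ φ ∈ admissiblePressures Ω, 0 ≤ inner ℝ (A q - (l₂ - γ • l₁)) (φ - q) := by
  refine and_congr Iff.rfl (forall₂_congr fun φ _ => ?_)
  rw [inner_sub_left, inner_sub_left, real_inner_smul_left, hA, hl₁, hl₂]
  have e1 := Lp.coeFn_sub φ.fst q.fst
  have e2 := Lp.coeFn_sub φ.snd q.snd
  have i1 : ∫ x in (Ω : Set Plane), (φ - q).fst x =
      ∫ x in (Ω : Set Plane), (φ.fst x - q.fst x) := integral_congr_ae e1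
  have i2 : ∫ x in (Ω : Set Plane), h₀ x * (φ - q).snd x 0 =
      ∫ x in (Ω : Set Plane), h₀ x * (φ.snd x - q.snd x) 0 :=
    integral_congr_ae (e2.mono fun x hx => by
      show h₀ x * (φ.snd - q.snd) x 0 = _
      rw [hx]; rfl)
  have i3 : ∫ x in (Ω : Set Plane), (h₀ x + β) ^ 3 * inner ℝ (q.snd x) ((φ - q).snd x) =
      ∫ x in (Ω : Set Plane), (h₀ x + β) ^ 3 * inner ℝ (q.snd x) (φ.snd x - q.snd x) :=
    integral_congr_ae (e2.mono fun x hx => by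
      show (h₀ x + β) ^ 3 * inner ℝ (q.snd x) ((φ.snd - q.snd) x) = _
      rw [hx]; rfl)
  rw [i1, i2, i3, ge_iff_le, sub_nonneg]

/-- Coercivity of the Reynolds operator on `H¹₀`. -/
theorem exists_coercive_constant (hbdd : Bornology.IsBounded (Ω : Set Plane)) :
    ∃ c : ℝ, 0 < c ∧ ∀ (h₀ : Plane → ℝ) (β : ℝ) (A : L2Pair Ω →L[ℝ] L2Pair Ω),
      IsC1UpToBoundary Ω h₀ → (∀ x ∈ Ω, 0 ≤ h₀ x) → 0 < β →
      (∀ p q, inner ℝ (A p) q =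
        ∫ x in (Ω : Set Plane), (h₀ x + β) ^ 3 * inner ℝ (p.snd x) (q.snd x)) →
      ∀ p ∈ admissiblePressures Ω, ∀ q ∈ admissiblePressures Ω,
        c * β ^ 3 * ‖p - q‖ ^ 2 ≤ inner ℝ (A (p - q)) (p - q) := by
  obtain ⟨R, hR⟩ := hbdd.exists_norm_le
  have hR' : (0 : ℝ) < 4 * R ^ 2 + 1 := by positivity
  -- The Poincaré constant for the full `H¹` norm; it depends on `Ω` alone, and all dependence on
  -- `β` sits in `β ^ 3`.
  refine ⟨(4 * R ^ 2 + 1)⁻¹, by positivity, fun h₀ β A hC1 hnn hβ hA p hp q hq => ?_⟩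
  have h1 := SobolevH10.norm_sq_le hR (sub_mem hp.1 hq.1)
  have h2 : β ^ 3 * ‖(p - q).snd‖ ^ 2 ≤ inner ℝ (A (p - q)) (p - q) := by
    rw [hA, norm_sq_eq_integral, ← integral_const_mul]
    have hi : Integrable (fun x => inner ℝ ((p - q).snd x) ((p - q).snd x))
        (volume.restrict (Ω : Set Plane)) := L2.integrable_inner _ _
    obtain ⟨W, -, hW⟩ := exists_continuous_weight hbdd hC1
    have hw : MemLp (fun x => (h₀ x + β) ^ 3) ⊤ (volume.restrict (Ω : Set Plane)) :=
      (memLp_congr_ae (hW β)).1 (Lp.memLp _)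
    refine integral_mono_ae ?_ (memLp_one_iff_integrable.1
      (MemLp.mul (memLp_one_iff_integrable.2 hi) hw)) ?_
    · simp only [← real_inner_self_eq_norm_sq]
      exact hi.const_mul _
    · filter_upwards [ae_restrict_mem Ω.isOpen.measurableSet] with x hx
      have h3 : β ^ 3 ≤ (h₀ x + β) ^ 3 :=
        pow_le_pow_left₀ hβ.le (by linarith [hnn x hx]) 3
      show β ^ 3 * ‖(p - q).snd x‖ ^ 2 ≤ (h₀ x + β) ^ 3 * inner ℝ ((p - q).snd x) ((p - q).snd x)
      rw [real_inner_self_eq_norm_sq]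
      exact mul_le_mul_of_nonneg_right h3 (sq_nonneg _)
  refine le_trans ?_ h2
  rw [mul_comm _ (β ^ 3), mul_assoc]
  refine mul_le_mul_of_nonneg_left ?_ (by positivity)
  rwa [inv_mul_le_iff₀ hR']

theorem existsUnique_isReynoldsSolution (hbdd : Bornology.IsBounded (Ω : Set Plane))
    (hC1 : IsC1UpToBoundary Ω h₀) (hnn : ∀ x ∈ Ω, 0 ≤ h₀ x) {β : ℝ} (γ : ℝ) (hβ : 0 < β) :
    ∃! q : L2Pair Ω, IsReynoldsSolution Ω h₀ β γ q := by
  obtain ⟨A, -, hA⟩ := exists_reynoldsOperator hbdd hC1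
  obtain ⟨l₁, hl₁⟩ := exists_inner_eq_integral_fst hbdd
  obtain ⟨l₂, hl₂⟩ := exists_inner_eq_integral_snd hbdd hC1
  obtain ⟨c, hc, hcoer⟩ := exists_coercive_constant hbdd
  have hco := hcoer h₀ β (A β) hC1 hnn hβ (hA β)
  have hcβ : 0 < c * β ^ 3 := by positivity
  simp only [isReynoldsSolution_iff (hA β) hl₁ hl₂]
  obtain ⟨u, hu, hu'⟩ := exists_variational_solution ⟨0, zero_mem_admissiblePressures⟩
    isClosed_admissiblePressures convex_admissiblePressures (A β) (l₂ - γ • l₁) hcβ hco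
  refine ⟨u, ⟨hu, hu'⟩, ?_⟩
  rintro v ⟨hv, hv'⟩
  -- Uniqueness is the stability estimate with both operators equal.
  have h := norm_variational_solution_sub_le hco hv hu hv' hu'
  rw [sub_self, norm_zero, zero_mul] at h
  have h2 : ‖v - u‖ ≤ 0 := by
    by_contra! h3
    exact absurd h (not_le.2 (mul_pos hcβ h3))
  exact sub_eq_zero.1 (norm_le_zero_iff.1 h2)

theorem isReynoldsSolution_reynoldsPressure (hbdd : Bornology.IsBounded (Ω : Set Plane))
    (hC1 : IsC1UpToBoundary Ω h₀) (hnn : ∀ x ∈ Ω, 0 ≤ h₀ x) {β : ℝ} (γ : ℝ) (hβ : 0 < β) :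
    IsReynoldsSolution Ω h₀ β γ (reynoldsPressure Ω h₀ β γ) :=
  Classical.epsilon_spec (existsUnique_isReynoldsSolution hbdd hC1 hnn γ hβ).exists

theorem continuousOn_reynoldsPressure (hbdd : Bornology.IsBounded (Ω : Set Plane))
    (hC1 : IsC1UpToBoundary Ω h₀) (hnn : ∀ x ∈ Ω, 0 ≤ h₀ x) (γ : ℝ) :
    ContinuousOn (fun β => reynoldsPressure Ω h₀ β γ) (Set.Ioi 0) := by
  obtain ⟨A, hAc, hA⟩ := exists_reynoldsOperator hbdd hC1
  obtain ⟨l₁, hl₁⟩ := exists_inner_eq_integral_fst hbdd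
  obtain ⟨l₂, hl₂⟩ := exists_inner_eq_integral_snd hbdd hC1
  obtain ⟨c, hc, hcoer⟩ := exists_coercive_constant hbdd
  intro β hβ
  have hβ' : 0 < β := hβ
  have hu : ∀ {b : ℝ}, 0 < b → _ := fun {b} hb => (isReynoldsSolution_iff (hA b) hl₁ hl₂ _).1
    (isReynoldsSolution_reynoldsPressure hbdd hC1 hnn γ hb)
  refine ContinuousAt.continuousWithinAt ?_
  rw [ContinuousAt, tendsto_iff_norm_sub_tendsto_zero]
  have hlim : Tendsto (fun b => ‖A b - A β‖ * ‖reynoldsPressure Ω h₀ β γ‖ / (c * b ^ 3))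
      (𝓝 β) (𝓝 0) := by
    have h1 : ContinuousAt
        (fun b => ‖A b - A β‖ * ‖reynoldsPressure Ω h₀ β γ‖ / (c * b ^ 3)) β := by
      refine ContinuousAt.div ?_ ?_ (by positivity)
      · exact ((hAc.sub continuous_const).norm.mul continuous_const).continuousAt
      · fun_prop
    simpa [ContinuousAt] using h1
  refine squeeze_zero' (.of_forall fun _ => norm_nonneg _) ?_ hlim
  filter_upwards [lt_mem_nhds hβ'] with b hb
  -- Coercivity is taken at the moving parameter `b`, so that only the norm of the fixed solution at
  -- `β` enters.
  have h := norm_variational_solution_sub_le (hcoer h₀ b (A b) hC1 hnn hb (hA b))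
    (hu hb).1 (hu hβ').1 (hu hb).2 (hu hβ').2
  rw [le_div_iff₀ (by positivity), mul_comm]
  exact h

theorem tendsto_reynoldsPressure_atTop (hbdd : Bornology.IsBounded (Ω : Set Plane))
    (hC1 : IsC1UpToBoundary Ω h₀) (hnn : ∀ x ∈ Ω, 0 ≤ h₀ x) (γ : ℝ) :
    Tendsto (fun β => reynoldsPressure Ω h₀ β γ) atTop (𝓝 0) := by
  obtain ⟨A, -, hA⟩ := exists_reynoldsOperator hbdd hC1
  obtain ⟨l₁, hl₁⟩ := exists_inner_eq_integral_fst hbdd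
  obtain ⟨l₂, hl₂⟩ := exists_inner_eq_integral_snd hbdd hC1
  obtain ⟨c, hc, hcoer⟩ := exists_coercive_constant hbdd
  rw [tendsto_zero_iff_norm_tendsto_zero]
  have hlim : Tendsto (fun b : ℝ => ‖l₂ - γ • l₁‖ / (c * b ^ 3)) atTop (𝓝 0) :=
    tendsto_const_nhds.div_atTop ((tendsto_pow_atTop three_ne_zero).const_mul_atTop hc)
  refine squeeze_zero' (.of_forall fun _ => norm_nonneg _) ?_ hlim
  filter_upwards [eventually_gt_atTop 0] with b hb
  have hu := (isReynoldsSolution_iff (hA b) hl₁ hl₂ _).1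
    (isReynoldsSolution_reynoldsPressure hbdd hC1 hnn γ hb)
  have h := norm_variational_solution_le zero_mem_admissiblePressures
    (hcoer h₀ b (A b) hC1 hnn hb (hA b)) hu.1 hu.2
  rw [le_div_iff₀ (by positivity), mul_comm]
  exact h

theorem continuousOn_reynoldsG (hbdd : Bornology.IsBounded (Ω : Set Plane))
    (hC1 : IsC1UpToBoundary Ω h₀) (hnn : ∀ x ∈ Ω, 0 ≤ h₀ x) (F γ : ℝ) :
    ContinuousOn (fun β => reynoldsG Ω h₀ F β γ) (Set.Ioi 0) := by
  obtain ⟨l, hl⟩ := exists_inner_eq_integral_fst hbdd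
  simp only [reynoldsG, ← hl]
  exact (continuousOn_const.inner (continuousOn_reynoldsPressure hbdd hC1 hnn γ)).sub
    continuousOn_const

theorem tendsto_reynoldsG_atTop (hbdd : Bornology.IsBounded (Ω : Set Plane))
    (hC1 : IsC1UpToBoundary Ω h₀) (hnn : ∀ x ∈ Ω, 0 ≤ h₀ x) (F γ : ℝ) :
    Tendsto (fun β => reynoldsG Ω h₀ F β γ) atTop (𝓝 (-F)) := by
  obtain ⟨l, hl⟩ := exists_inner_eq_integral_fst hbdd
  simp only [reynoldsG, ← hl]
  have h := ((tendsto_const_nhds (x := l)).inner (𝕜 := ℝ)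
    (tendsto_reynoldsPressure_atTop hbdd hC1 hnn γ)).sub_const F
  simpa using h

/-- Testing the Reynolds inequality with `q + p`. -/
theorem IsReynoldsSolution.le_integral (hbdd : Bornology.IsBounded (Ω : Set Plane))
    (hC1 : IsC1UpToBoundary Ω h₀) {β γ : ℝ} {q : L2Pair Ω} (hq : IsReynoldsSolution Ω h₀ β γ q)
    {p : L2Pair Ω} (hp : p ∈ admissiblePressures Ω) :
    (∫ x in (Ω : Set Plane), h₀ x * p.snd x 0) - γ * ∫ x in (Ω : Set Plane), p.fst x ≤
      ∫ x in (Ω : Set Plane), (h₀ x + β) ^ 3 * inner ℝ (q.snd x) (p.snd x) := by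
  obtain ⟨A, -, hA⟩ := exists_reynoldsOperator hbdd hC1
  obtain ⟨l₁, hl₁⟩ := exists_inner_eq_integral_fst hbdd
  obtain ⟨l₂, hl₂⟩ := exists_inner_eq_integral_snd hbdd hC1
  obtain ⟨h1, h2⟩ := (isReynoldsSolution_iff (hA β) hl₁ hl₂ _).1 hq
  have h3 := h2 (q + p) (add_mem_admissiblePressures h1 hp)
  rw [add_sub_cancel_left, inner_sub_left, inner_sub_left, real_inner_smul_left, hA, hl₁, hl₂] at h3
  linarith

end ReynoldsOperator

/-! ### Duality bound for the load -/

section LowerBound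

open Filter Topology

variable {Ω : Opens Plane} {h₀ : Plane → ℝ}

theorem IsC1UpToBoundary.contDiffAt (hC1 : IsC1UpToBoundary Ω h₀) {x : Plane} (hx : x ∈ Ω) :
    ContDiffAt ℝ 1 h₀ x := by
  obtain ⟨-, hd, g, hg, hfg⟩ := hC1
  refine contDiffAt_one_iff.2 ⟨g, Ω, Ω.isOpen.mem_nhds hx, hg.mono subset_closure,
    fun y hy => ?_⟩
  rw [← hfg y hy]
  exact ((hd y hy).differentiableAt (Ω.isOpen.mem_nhds hy)).hasFDerivAt

/-- The weight is regular only inside `Ω`; at any other point the product vanishes nearby. -/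
theorem contDiff_mul_of_tsupport_subset {F : Type*} [NormedAddCommGroup F] [NormedSpace ℝ F]
    {w : Plane → ℝ} {f : Plane → F} (hw : ∀ x ∈ Ω, ContDiffAt ℝ 1 w x) (hf : ContDiff ℝ 1 f)
    (hs : tsupport f ⊆ Ω) : ContDiff ℝ 1 fun x => w x • f x := by
  rw [contDiff_iff_contDiffAt]
  intro x
  by_cases hx : x ∈ Ω
  · exact (hw x hx).smul hf.contDiffAt
  · have h0 : f =ᶠ[𝓝 x] 0 := notMem_tsupport_iff_eventuallyEq.1 fun h => hx (hs h)
    have h1 : (fun x => w x • f x) =ᶠ[𝓝 x] fun _ => (0 : F) := by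
      filter_upwards [h0] with y hy
      rw [hy, Pi.zero_apply, smul_zero]
    exact contDiffAt_const.congr_of_eventuallyEq h1

theorem contDiff_gradient_testFunction (φ : 𝓓(Ω, ℝ)) : ContDiff ℝ 1 (gradient φ) :=
  (InnerProductSpace.toDual ℝ Plane).symm.contDiff.comp
    (φ.contDiff.fderiv_right (m := 1)
      (WithTop.coe_le_coe.2 (le_top : (1 + 1 : ℕ∞) ≤ ⊤)))

theorem tsupport_gradient_testFunction_subset (φ : 𝓓(Ω, ℝ)) : tsupport (gradient φ) ⊆ Ω := by
  refine Set.Subset.trans (closure_mono fun x hx => ?_)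
    ((tsupport_fderiv_subset ℝ (f := φ)).trans φ.tsupport_subset)
  rw [Function.mem_support] at hx ⊢
  exact fun h => hx (by rw [gradient, h, map_zero])

theorem integrable_mul_of_tsupport_subset {φ : 𝓓(Ω, ℝ)} {u v : Plane → ℝ}
    (hu : ContinuousOn u Ω) (hv : Continuous v) (hs : tsupport v ⊆ tsupport φ) :
    Integrable fun x => u x * v x := by
  have hs' : tsupport (fun x => u x * v x) ⊆ tsupport φ :=
    (tsupport_mul_subset_right (f := u) (g := v)).trans hs
  exact ((hu.mul hv.continuousOn).continuous_of_tsupport_subset Ω.isOpen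
    (hs'.trans φ.tsupport_subset)).integrable_of_hasCompactSupport
    (φ.hasCompactSupport.of_isClosed_subset (isClosed_tsupport _) hs')

theorem IsC1UpToBoundary.integrable_fderiv_mul (hC1 : IsC1UpToBoundary Ω h₀) (φ : 𝓓(Ω, ℝ))
    (v : Plane) : Integrable fun x => fderiv ℝ h₀ x v * φ x := by
  obtain ⟨-, -, g, hg, hfg⟩ := hC1
  exact integrable_mul_of_tsupport_subset
    (((hg.mono subset_closure).congr hfg).clm_apply continuousOn_const) φ.continuous subset_rfl

theorem integral_mul_gradient_zero (hC1 : IsC1UpToBoundary Ω h₀) (φ : 𝓓(Ω, ℝ)) :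
    ∫ x, h₀ x * gradient φ x 0 = -∫ x, fderiv ℝ h₀ x (EuclideanSpace.single 0 1) * φ x := by
  have hφ := contDiff_one_testFunction φ
  have hc : ContinuousOn h₀ Ω := hC1.1.mono subset_closure
  simp only [gradient_apply]
  refine integral_mul_fderiv_eq_neg_fderiv_mul_of_integrable (hC1.integrable_fderiv_mul φ _)
    (integrable_mul_of_tsupport_subset hc ((hφ.continuous_fderiv one_ne_zero).clm_apply continuous_const)
      (tsupport_fderiv_apply_subset ℝ _)) (integrable_mul_of_tsupport_subset hc φ.continuous subset_rfl)
    (fun x hx => (hC1.contDiffAt (φ.tsupport_subset hx)).differentiableAt one_ne_zero)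
    (fun x _ => hφ.differentiable one_ne_zero x)

/-- The flux `(h₀ + β)³ ∇φ` is `C¹` with compact support in `Ω`, so all derivatives can be moved off
`p`. -/
theorem SobolevH10.integral_weight_inner_gradient_eq (hC1 : IsC1UpToBoundary Ω h₀) (β : ℝ)
    {p : L2Pair Ω} (hp : p ∈ SobolevH10 Ω) (φ : 𝓓(Ω, ℝ)) :
    ∫ x in (Ω : Set Plane), (h₀ x + β) ^ 3 * inner ℝ (p.snd x) (gradient φ x) =
      -∫ x in (Ω : Set Plane), p.fst x * ∑ i, fderiv ℝ (fun y => (h₀ y + β) ^ 3 *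
        fderiv ℝ φ y (EuclideanSpace.single i 1)) x (EuclideanSpace.single i 1) := by
  have hX : ContDiff ℝ 1 fun x => (h₀ x + β) ^ 3 • gradient φ x := contDiff_mul_of_tsupport_subset
    (fun x hx => ((hC1.contDiffAt hx).add contDiffAt_const).pow 3)
    (contDiff_gradient_testFunction φ) (tsupport_gradient_testFunction_subset φ)
  have hXc : HasCompactSupport fun x => (h₀ x + β) ^ 3 • gradient φ x :=
    HasCompactSupport.intro (gradient_testFunction_hasCompactSupport φ) fun x hx => by
      rw [image_eq_zero_of_notMem_tsupport hx, smul_zero]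
  have h2 := SobolevH10.integral_inner_eq hp hX hXc
  simpa only [real_inner_smul_right, PiLp.smul_apply, smul_eq_mul, gradient_apply] using h2

/-- Duality estimate: a nonnegative test function with small flux divergence forces the load of
the pressure to be large. -/
theorem IsReynoldsSolution.neg_integral_le (hbdd : Bornology.IsBounded (Ω : Set Plane))
    (hC1 : IsC1UpToBoundary Ω h₀) {β : ℝ} {q : L2Pair Ω} (hq : IsReynoldsSolution Ω h₀ β 0 q)
    {φ : 𝓓(Ω, ℝ)} (hφ0 : ∀ x, 0 ≤ φ x) {C : ℝ}
    (hC : ∀ x ∈ Ω, |∑ i, fderiv ℝ (fun y => (h₀ y + β) ^ 3 *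
      fderiv ℝ φ y (EuclideanSpace.single i 1)) x (EuclideanSpace.single i 1)| ≤ C) :
    -∫ x, fderiv ℝ h₀ x (EuclideanSpace.single 0 1) * φ x ≤
      C * ∫ x in (Ω : Set Plane), q.fst x := by
  have h1 := hq.le_integral hbdd hC1 (testPair_mem_admissiblePressures hφ0)
  have h2 := SobolevH10.integral_weight_inner_gradient_eq hC1 β hq.1.1 φ
  have e1 : ∫ x in (Ω : Set Plane), h₀ x * (testPair φ).snd x 0 = ∫ x, h₀ x * gradient φ x 0 := by
    rw [← setIntegral_eq_integral_of_eq_zero_off (s := (Ω : Set Plane)) fun x hx => by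
      rw [gradient_testFunction_eq_zero_of_notMem φ hx, PiLp.zero_apply, mul_zero]]
    refine integral_congr_ae ((testPair_snd φ).mono fun x hx => ?_)
    simp only [hx]
  have e2 : ∫ x in (Ω : Set Plane), (h₀ x + β) ^ 3 * inner ℝ (q.snd x) ((testPair φ).snd x) =
      ∫ x in (Ω : Set Plane), (h₀ x + β) ^ 3 * inner ℝ (q.snd x) (gradient φ x) := by
    refine integral_congr_ae ((testPair_snd φ).mono fun x hx => ?_)
    simp only [hx]
  rw [zero_mul, sub_zero, e1, e2, h2, integral_mul_gradient_zero hC1] at h1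
  refine h1.trans ?_
  rw [← integral_neg, ← integral_const_mul]
  have hfin : IsFiniteMeasure (volume.restrict (Ω : Set Plane)) :=
    ⟨by simpa using hbdd.measure_lt_top⟩
  have hint : Integrable q.fst (volume.restrict (Ω : Set Plane)) :=
    (Lp.memLp q.fst).integrable (by norm_num)
  have hD : Measurable fun x => ∑ i, fderiv ℝ (fun y => (h₀ y + β) ^ 3 *
      fderiv ℝ φ y (EuclideanSpace.single i 1)) x (EuclideanSpace.single i 1) :=
    Finset.measurable_sum _ fun i _ => measurable_fderiv_apply_const ℝ _ _
  have hae := ae_restrict_mem (μ := volume) Ω.isOpen.measurableSet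
  refine integral_mono_ae (hint.mul_bdd (c := C) hD.aestronglyMeasurable ?_).neg
    (hint.const_mul C) ?_
  · filter_upwards [hae] with x hx using hC x hx
  · filter_upwards [hae, hq.1.2] with x hx hqx
    -- Nonnegativity of the pressure turns the bound on the divergence into a bound by the load
    -- itself.
    have h3 := (abs_le.1 (hC x hx)).1
    nlinarith

end LowerBound

/-! ### Product bump functions and their scaling -/

section SeparatedBump

open Filter Topology

/-- A smooth bump function on the line with controlled first two derivatives. -/
theorem exists_smooth_bump (c : ℝ) {r : ℝ} (hr : 0 < r) :
    ∃ ρ : ℝ → ℝ, ContDiff ℝ ∞ ρ ∧ (∀ t, 0 ≤ ρ t) ∧ (∀ t, ρ t ≠ 0 → |t - c| ≤ r) ∧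
      0 < ∫ t, ρ t ∧ ∃ M, 0 < M ∧
        ∀ t, |ρ t| ≤ M ∧ |deriv ρ t| ≤ M ∧ |deriv (deriv ρ) t| ≤ M := by
  let f : ContDiffBump c := ⟨r / 2, r, by positivity, by linarith⟩
  have hf : ContDiff ℝ ∞ f := f.contDiff
  have hf1 : ContDiff ℝ ∞ (deriv f) := (contDiff_infty_iff_deriv.1 hf).2
  have hf2 : ContDiff ℝ ∞ (deriv (deriv f)) := (contDiff_infty_iff_deriv.1 hf1).2
  have hc : HasCompactSupport f := f.hasCompactSupport
  obtain ⟨M0, h0⟩ := hc.exists_bound_of_continuous hf.continuous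
  obtain ⟨M1, h1⟩ := hc.deriv.exists_bound_of_continuous hf1.continuous
  obtain ⟨M2, h2⟩ := hc.deriv.deriv.exists_bound_of_continuous hf2.continuous
  refine ⟨f, hf, fun t => f.nonneg, fun t ht => ?_, f.integral_pos, |M0| + |M1| + |M2| + 1,
    by positivity, fun t => ⟨?_, ?_, ?_⟩⟩
  · have h := subset_tsupport f (Function.mem_support.2 ht)
    rw [f.tsupport_eq] at h
    exact h
  · have := h0 t
    rw [Real.norm_eq_abs] at this
    linarith [le_abs_self M0, abs_nonneg M1, abs_nonneg M2]
  · have := h1 t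
    rw [Real.norm_eq_abs] at this
    linarith [le_abs_self M1, abs_nonneg M0, abs_nonneg M2]
  · have := h2 t
    rw [Real.norm_eq_abs] at this
    linarith [le_abs_self M2, abs_nonneg M1, abs_nonneg M0]

theorem fderiv_separated {a b : ℝ → ℝ} (ha : ContDiff ℝ ∞ a) (hb : ContDiff ℝ ∞ b)
    (x v : Plane) : fderiv ℝ (fun y : Plane => a (y 0) * b (y 1)) x v =
      deriv a (x 0) * v 0 * b (x 1) + a (x 0) * (deriv b (x 1) * v 1) := by
  have h0 : HasFDerivAt (fun y : Plane => y 0) (EuclideanSpace.proj 0 : Plane →L[ℝ] ℝ) x :=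
    (EuclideanSpace.proj 0 : Plane →L[ℝ] ℝ).hasFDerivAt
  have h1 : HasFDerivAt (fun y : Plane => y 1) (EuclideanSpace.proj 1 : Plane →L[ℝ] ℝ) x :=
    (EuclideanSpace.proj 1 : Plane →L[ℝ] ℝ).hasFDerivAt
  have ha' := (ha.differentiable (by simp) (x 0)).hasDerivAt.comp_hasFDerivAt x h0
  have hb' := (hb.differentiable (by simp) (x 1)).hasDerivAt.comp_hasFDerivAt x h1
  have h := (ha'.mul hb').fderiv
  refine (congrArg (fun l : Plane →L[ℝ] ℝ => l v) h).trans ?_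
  simp
  ring

theorem fderiv_separated_zero {a b : ℝ → ℝ} (ha : ContDiff ℝ ∞ a) (hb : ContDiff ℝ ∞ b)
    (x : Plane) : fderiv ℝ (fun y : Plane => a (y 0) * b (y 1)) x (EuclideanSpace.single 0 1) =
      deriv a (x 0) * b (x 1) := by
  rw [fderiv_separated ha hb]; simp

theorem fderiv_separated_one {a b : ℝ → ℝ} (ha : ContDiff ℝ ∞ a) (hb : ContDiff ℝ ∞ b)
    (x : Plane) : fderiv ℝ (fun y : Plane => a (y 0) * b (y 1)) x (EuclideanSpace.single 1 1) =
      a (x 0) * deriv b (x 1) := by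
  rw [fderiv_separated ha hb]; simp

theorem integral_separated (a b : ℝ → ℝ) :
    ∫ x : Plane, a (x 0) * b (x 1) = (∫ t, a t) * ∫ t, b t := by
  have h1 := (EuclideanSpace.volume_preserving_symm_measurableEquiv_toLp (Fin 2)).integral_comp'
    (fun y : Fin 2 → ℝ => a (y 0) * b (y 1))
  have h2 := integral_fintype_prod_volume_eq_prod (ι := Fin 2) (E := fun _ => ℝ) (𝕜 := ℝ) ![a, b]
  simp only [Fin.prod_univ_two, Matrix.cons_val_zero, Matrix.cons_val_one] at h2
  rw [← h2]
  exact h1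

theorem deriv_comp_div_eq (a : ℝ → ℝ) (ε : ℝ) :
    deriv (fun t => a (t / ε)) = fun t => ε⁻¹ * deriv a (t / ε) := by
  ext t
  have h := deriv_comp_mul_left ε⁻¹ a t
  simpa only [div_eq_inv_mul, smul_eq_mul] using h

theorem deriv_deriv_comp_div_eq (a : ℝ → ℝ) (ε : ℝ) :
    deriv (deriv fun t => a (t / ε)) = fun t => ε⁻¹ ^ 2 * deriv (deriv a) (t / ε) := by
  ext t
  rw [deriv_comp_div_eq, deriv_const_mul_field, deriv_comp_div_eq]
  ring

end SeparatedBump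

/-! ### Load estimate from a box beside the contact -/

section LoadEstimate

open Filter Topology

variable {Ω : Opens Plane} {h₀ : Plane → ℝ}

/-- The box `[-2ε, -ε] × [-δ, δ]`, on the converging side of the contact. -/
def contactBox (ε δ : ℝ) : Set Plane := {x | -(2 * ε) ≤ x 0 ∧ x 0 ≤ -ε ∧ |x 1| ≤ δ}

theorem isClosed_contactBox (ε δ : ℝ) : IsClosed (contactBox ε δ) := by
  have h0 := (contDiff_coord 0).continuous
  have h1 := (contDiff_coord 1).continuous
  exact (isClosed_le continuous_const h0).inter
    ((isClosed_le h0 continuous_const).inter (isClosed_le h1.abs continuous_const))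

theorem norm_le_of_mem_contactBox {ε δ : ℝ} {x : Plane} (hε : 0 ≤ ε) (hx : x ∈ contactBox ε δ) :
    ‖x‖ ≤ 2 * ε + δ := by
  obtain ⟨h1, h2, h3⟩ := hx
  have hδ : 0 ≤ δ := (abs_nonneg _).trans h3
  rw [EuclideanSpace.norm_eq, Fin.sum_univ_two, Real.norm_eq_abs, Real.norm_eq_abs, sq_abs]
  refine Real.sqrt_le_iff.2 ⟨by positivity, ?_⟩
  have h4 : |x 1| ^ 2 ≤ δ ^ 2 := pow_le_pow_left₀ (abs_nonneg _) h3 2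
  nlinarith [mul_nonneg hε hδ]

theorem isCompact_contactBox {ε : ℝ} (δ : ℝ) (hε : 0 ≤ ε) : IsCompact (contactBox ε δ) :=
  (isCompact_closedBall (0 : Plane) (2 * ε + δ)).of_isClosed_subset (isClosed_contactBox ε δ)
    fun _ hx => mem_closedBall_zero_iff.2 (norm_le_of_mem_contactBox hε hx)

theorem exists_separated_testFunction {a b : ℝ → ℝ} (ha : ContDiff ℝ ∞ a)
    (hb : ContDiff ℝ ∞ b) {S : Set Plane} (hS : IsCompact S) (hSΩ : S ⊆ Ω)
    (hsupp : ∀ x : Plane, a (x 0) * b (x 1) ≠ 0 → x ∈ S) :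
    ∃ φ : 𝓓(Ω, ℝ), (φ : Plane → ℝ) = fun x => a (x 0) * b (x 1) := by
  have ht : tsupport (fun x : Plane => a (x 0) * b (x 1)) ⊆ S :=
    closure_minimal hsupp hS.isClosed
  exact ⟨⟨fun x => a (x 0) * b (x 1),
    (ha.comp (EuclideanSpace.proj 0 : Plane →L[ℝ] ℝ).contDiff).mul
      (hb.comp (EuclideanSpace.proj 1 : Plane →L[ℝ] ℝ).contDiff),
    hS.of_isClosed_subset (isClosed_tsupport _) ht, ht.trans hSΩ⟩, rfl⟩

theorem fderiv_cube_mul {w ψ : Plane → ℝ} {x : Plane} (hw : DifferentiableAt ℝ w x)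
    (hψ : DifferentiableAt ℝ ψ x) (t : ℝ) (v : Plane) :
    fderiv ℝ (fun y => (w y + t) ^ 3 * ψ y) x v =
      (w x + t) ^ 3 * fderiv ℝ ψ x v + ψ x * (3 * (w x + t) ^ 2 * fderiv ℝ w x v) := by
  have h := (((hw.hasFDerivAt.add_const t).pow 3).mul hψ.hasFDerivAt).fderiv
  refine (congrArg (fun l : Plane →L[ℝ] ℝ => l v) h).trans ?_
  simp

/-- One coordinate of the flux divergence: the factor `4` is `1` from the second derivative of the
bump plus `3` from differentiating the cube. -/
theorem abs_cube_mul_add_le {H p d g P K t ε : ℝ} (hP : 0 ≤ P) (hK : 0 ≤ K) (ht : 0 < t)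
    (hε : 0 < ε) (hH0 : 0 ≤ H) (hH : H ≤ (P + 1) * t) (hp : |p| ≤ K / ε) (hd : |d| ≤ K / ε ^ 2)
    (hg : |g| ≤ P * t / ε) :
    |H ^ 3 * d + p * (3 * H ^ 2 * g)| ≤ 4 * (P + 1) ^ 3 * K * t ^ 3 / ε ^ 2 := by
  have h1 : |H ^ 3 * d| ≤ ((P + 1) * t) ^ 3 * (K / ε ^ 2) := by
    rw [abs_mul, abs_of_nonneg (pow_nonneg hH0 3)]
    exact mul_le_mul (pow_le_pow_left₀ hH0 hH 3) hd (abs_nonneg _) (by positivity)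
  have h2 : |p * (3 * H ^ 2 * g)| ≤ K / ε * (3 * ((P + 1) * t) ^ 2 * ((P + 1) * t / ε)) := by
    rw [abs_mul, abs_mul, abs_of_nonneg (by positivity : 0 ≤ 3 * H ^ 2)]
    refine mul_le_mul hp (mul_le_mul ?_ (hg.trans ?_) (abs_nonneg _) (by positivity))
      (by positivity) (by positivity)
    · exact mul_le_mul_of_nonneg_left (pow_le_pow_left₀ hH0 hH 2) (by norm_num)
    · gcongr; linarith
  refine (abs_add_le _ _).trans ((add_le_add h1 h2).trans (le_of_eq ?_))
  field_simp
  ring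

/-- Lower bound for the load in terms of the size of `h₀` on a box next to the contact. -/
theorem exists_load_constant : ∃ κ : ℝ, 0 < κ ∧ ∀ (Ω : Opens Plane) (h₀ : Plane → ℝ),
    Bornology.IsBounded (Ω : Set Plane) → IsC1UpToBoundary Ω h₀ →
    ∀ P m ε δ t : ℝ, 0 ≤ P → 0 < ε → ε ≤ δ → 0 < t → contactBox ε δ ⊆ Ω →
    (∀ x ∈ contactBox ε δ, 0 ≤ h₀ x ∧ h₀ x ≤ P * t ∧
      (∀ i : Fin 2, |fderiv ℝ h₀ x (EuclideanSpace.single i 1)| ≤ P * t / ε) ∧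
      fderiv ℝ h₀ x (EuclideanSpace.single 0 1) ≤ -(m * t / ε)) →
    ∀ q, IsReynoldsSolution Ω h₀ t 0 q →
      κ * (m / (P + 1) ^ 3) * (δ * ε ^ 2 / t ^ 2) ≤ ∫ x in (Ω : Set Plane), q.fst x := by
  -- Centre `-3/2` and radius `1/2` confine `ρ` to `[-2, -1]`, hence `ρ (· / ε)` to `[-2ε, -ε]`.
  obtain ⟨ρ, hρ, hρ0, hρs, hρI, M, hM, hρM⟩ :=
    exists_smooth_bump (-(3 / 2)) (one_half_pos (α := ℝ))
  obtain ⟨σ, hσ, hσ0, hσs, hσI, M', hM', hσM⟩ := exists_smooth_bump 0 one_pos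
  set K : ℝ := M * M' with hK
  have hK0 : 0 < K := mul_pos hM hM'
  -- The `8` is twice the `4` of `abs_cube_mul_add_le`, one for each coordinate.
  refine ⟨(∫ t, ρ t) * (∫ t, σ t) / (8 * K), by positivity, ?_⟩
  intro Ω h₀ hbdd hC1 P m ε δ t hP hε hεδ ht hbox hh q hq
  have hδ : 0 < δ := hε.trans_le hεδ
  have hdiv : ∀ c : ℝ, ContDiff ℝ ∞ fun s : ℝ => s / c := fun c => contDiff_id.div_const c
  set a : ℝ → ℝ := fun s => ρ (s / ε) with ha_def
  set b : ℝ → ℝ := fun s => σ (s / δ) with hb_def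
  have ha : ContDiff ℝ ∞ a := hρ.comp (hdiv ε)
  have hb : ContDiff ℝ ∞ b := hσ.comp (hdiv δ)
  have ha1 : ContDiff ℝ ∞ (deriv a) := (contDiff_infty_iff_deriv.1 ha).2
  have hb1 : ContDiff ℝ ∞ (deriv b) := (contDiff_infty_iff_deriv.1 hb).2
  have hsupp : ∀ x : Plane, a (x 0) * b (x 1) ≠ 0 → x ∈ contactBox ε δ := by
    intro x hx
    have h1 := abs_le.1 (hρs _ (left_ne_zero_of_mul hx))
    have h2 := hσs _ (right_ne_zero_of_mul hx)
    rw [sub_zero, abs_div, abs_of_pos hδ, div_le_one hδ] at h2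
    refine ⟨?_, ?_, h2⟩
    · have h3 : -2 ≤ x 0 / ε := by linarith [h1.1]
      rw [le_div_iff₀ hε] at h3
      linarith
    · have h3 : x 0 / ε ≤ -1 := by linarith [h1.2]
      rw [div_le_iff₀ hε] at h3
      linarith
  obtain ⟨φ, hφ⟩ := exists_separated_testFunction ha hb (isCompact_contactBox δ hε.le) hbox hsupp
  have hφ0 : ∀ x, 0 ≤ φ x := fun x => by
    rw [hφ]; exact mul_nonneg (hρ0 _) (hσ0 _)
  have hφS : ∀ x ∉ contactBox ε δ, φ x = 0 := fun x hx => by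
    by_contra h
    rw [hφ] at h
    exact hx (hsupp x h)
  have hKb : ∀ {u v : ℝ}, |u| ≤ M → |v| ≤ M' → |u * v| ≤ K := fun {u v} hu hv => by
    rw [abs_mul]; exact mul_le_mul hu hv (abs_nonneg _) hM.le
  have hε' : 0 < ε⁻¹ := inv_pos.2 hε
  have hδ' : 0 < δ⁻¹ := inv_pos.2 hδ
  -- As `ε ≤ δ`, derivatives in the long direction obey the same bounds as those in the short one.
  have hδε : δ⁻¹ ≤ ε⁻¹ := inv_anti₀ hε hεδ
  have hD : ∀ x ∈ Ω, |∑ i, fderiv ℝ (fun y => (h₀ y + t) ^ 3 *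
      fderiv ℝ φ y (EuclideanSpace.single i 1)) x (EuclideanSpace.single i 1)| ≤
      8 * (P + 1) ^ 3 * K * t ^ 3 / ε ^ 2 := by
    intro x hx
    by_cases hxS : x ∈ contactBox ε δ
    · obtain ⟨g0, g1, g2, -⟩ := hh x hxS
      have hH0 : 0 ≤ h₀ x + t := by linarith
      have hH : h₀ x + t ≤ (P + 1) * t := by linarith
      have hdh : DifferentiableAt ℝ h₀ x := (hC1.contDiffAt hx).differentiableAt one_ne_zero
      have hds : ∀ {u v : ℝ → ℝ}, ContDiff ℝ ∞ u → ContDiff ℝ ∞ v →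
          DifferentiableAt ℝ (fun y : Plane => u (y 0) * v (y 1)) x := fun {u v} hu hv =>
        ((hu.comp (EuclideanSpace.proj 0 : Plane →L[ℝ] ℝ).contDiff).mul
          (hv.comp (EuclideanSpace.proj 1 : Plane →L[ℝ] ℝ).contDiff)).differentiable
          (by simp) x
      rw [Fin.sum_univ_two, hφ]
      simp only [fderiv_separated_zero ha hb, fderiv_separated_one ha hb]
      rw [fderiv_cube_mul hdh (hds ha1 hb), fderiv_cube_mul hdh (hds ha hb1),
        fderiv_separated_zero ha1 hb, fderiv_separated_one ha hb1, ha_def, hb_def,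
        deriv_deriv_comp_div_eq, deriv_deriv_comp_div_eq, deriv_comp_div_eq, deriv_comp_div_eq]
      have hr := hρM (x 0 / ε)
      have hs := hσM (x 1 / δ)
      refine (abs_add_le _ _).trans ((add_le_add
        (abs_cube_mul_add_le hP hK0.le ht hε hH0 hH ?_ ?_ (g2 0))
        (abs_cube_mul_add_le hP hK0.le ht hε hH0 hH ?_ ?_ (g2 1))).trans (le_of_eq (by ring)))
      · rw [mul_assoc, abs_mul, abs_of_pos hε', div_eq_inv_mul K]
        exact mul_le_mul_of_nonneg_left (hKb hr.2.1 hs.1) hε'.le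
      · rw [mul_assoc, abs_mul, abs_of_pos (pow_pos hε' 2), div_eq_inv_mul K, ← inv_pow]
        exact mul_le_mul_of_nonneg_left (hKb hr.2.2 hs.1) (by positivity)
      · rw [mul_left_comm, abs_mul, abs_of_pos hδ', div_eq_inv_mul K]
        exact mul_le_mul hδε (hKb hr.1 hs.2.1) (abs_nonneg _) hε'.le
      · rw [mul_left_comm, abs_mul, abs_of_pos (pow_pos hδ' 2), div_eq_inv_mul K, ← inv_pow]
        exact mul_le_mul (pow_le_pow_left₀ hδ'.le hδε 2) (hKb hr.1 hs.2.2) (abs_nonneg _)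
          (by positivity)
    -- Off the closed box the flux vanishes on a whole neighbourhood, and so does its divergence.
    · have hnear : ∀ᶠ y in 𝓝 x, y ∉ contactBox ε δ :=
        (isClosed_contactBox ε δ).isOpen_compl.mem_nhds hxS
      have hzero : ∀ i : Fin 2, (fun y => (h₀ y + t) ^ 3 *
          fderiv ℝ φ y (EuclideanSpace.single i 1)) =ᶠ[𝓝 x] fun _ => 0 := fun i => by
        filter_upwards [hnear.eventually_nhds] with y hy
        have h1 : (φ : Plane → ℝ) =ᶠ[𝓝 y] fun _ => 0 := hy.mono hφS
        rw [h1.fderiv_eq]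
        simp
      have hsum : ∑ i, fderiv ℝ (fun y => (h₀ y + t) ^ 3 *
          fderiv ℝ φ y (EuclideanSpace.single i 1)) x (EuclideanSpace.single i 1) = 0 :=
        Finset.sum_eq_zero fun i _ => by rw [(hzero i).fderiv_eq]; simp
      rw [hsum, abs_zero]
      positivity
  have hmain := hq.neg_integral_le hbdd hC1 hφ0 hD
  -- The driving term: the slope bound on the box times the mass of the scaled bump.
  have hgain : m * t / ε * (ε * δ * ((∫ s, ρ s) * ∫ s, σ s)) ≤
      -∫ x, fderiv ℝ h₀ x (EuclideanSpace.single 0 1) * φ x := by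
    have e : ε * δ * ((∫ s, ρ s) * ∫ s, σ s) = ∫ x, φ x := by
      rw [hφ, integral_separated, ha_def, hb_def, Measure.integral_comp_div,
        Measure.integral_comp_div, abs_of_pos hε, abs_of_pos hδ, smul_eq_mul, smul_eq_mul]
      ring
    rw [e, ← integral_const_mul, ← integral_neg]
    refine integral_mono
      ((φ.continuous.integrable_of_hasCompactSupport φ.hasCompactSupport).const_mul _)
      (hC1.integrable_fderiv_mul φ _).neg fun x => ?_
    show m * t / ε * φ x ≤ -(fderiv ℝ h₀ x (EuclideanSpace.single 0 1) * φ x)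
    by_cases hxS : x ∈ contactBox ε δ
    · rw [← neg_mul]
      exact mul_le_mul_of_nonneg_right (by linarith [(hh x hxS).2.2.2]) (hφ0 x)
    · rw [hφS x hxS, mul_zero, mul_zero, neg_zero]
  have h := hgain.trans hmain
  have hCpos : 0 < 8 * (P + 1) ^ 3 * K * t ^ 3 / ε ^ 2 := by positivity
  refine le_of_mul_le_mul_left (le_trans (le_of_eq ?_) h) hCpos
  field_simp

end LoadEstimate

/-! ### Size and slope of the gap near the contact -/

section ContactEstimates

open Filter Topology

variable {Ω : Opens Plane} {h₀ : Plane → ℝ}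

/-- Near `0`, a positive `C¹` function is bounded, bounded below, and has bounded derivative. -/
theorem exists_bounds_of_contDiffOn {W : Opens Plane} {h₁ : Plane → ℝ} (h0W : (0 : Plane) ∈ W)
    (hh₁ : ContDiffOn ℝ 1 h₁ (W : Set Plane)) (hpos : ∀ x ∈ W, 0 < h₁ x) :
    ∃ r m M : ℝ, 0 < r ∧ 0 < m ∧ 0 < M ∧ ∀ x : Plane, ‖x‖ ≤ r → x ∈ W ∧ m ≤ h₁ x ∧ h₁ x ≤ M ∧
      ∀ v, |fderiv ℝ h₁ x v| ≤ M * ‖v‖ := by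
  obtain ⟨r, hr, hrW⟩ := Metric.nhds_basis_closedBall.mem_iff.1 (W.isOpen.mem_nhds h0W)
  have hcomp : IsCompact (Metric.closedBall (0 : Plane) r) := isCompact_closedBall _ _
  have hne : (Metric.closedBall (0 : Plane) r).Nonempty := ⟨0, Metric.mem_closedBall_self hr.le⟩
  have hc : ContinuousOn h₁ (Metric.closedBall 0 r) := hh₁.continuousOn.mono hrW
  obtain ⟨y, hy, hmin⟩ := hcomp.exists_isMinOn hne hc
  obtain ⟨M₁, hM₁⟩ := hcomp.exists_bound_of_continuousOn hc
  obtain ⟨M₂, hM₂⟩ := hcomp.exists_bound_of_continuousOn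
    ((hh₁.continuousOn_fderiv_of_isOpen W.isOpen le_rfl).mono hrW)
  refine ⟨r, h₁ y, |M₁| + |M₂| + 1, hr, hpos y (hrW hy), by positivity, fun x hx => ?_⟩
  have hx' : x ∈ Metric.closedBall (0 : Plane) r := mem_closedBall_zero_iff.2 hx
  refine ⟨hrW hx', hmin hx', ?_, fun v => ?_⟩
  · have h1 := (le_abs_self _).trans (hM₁ x hx')
    linarith [le_abs_self M₁, abs_nonneg M₂]
  · refine ((fderiv ℝ h₁ x).le_opNorm v).trans (mul_le_mul_of_nonneg_right ?_ (norm_nonneg v))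
    linarith [hM₂ x hx', le_abs_self M₂, abs_nonneg M₁]

/-- Pointwise estimates for `N ^ α * h₁` where `N` is comparable to `ε` and decreasing in the
first direction. -/
theorem rpow_mul_estimates {N h₁ : Plane → ℝ} {N' : Plane →L[ℝ] ℝ} {x : Plane} {α ε m M : ℝ}
    (hα : 1 < α) (hε : 0 < ε) (hε1 : ε ≤ 1) (hm : 0 < m) (hM : 0 < M)
    (hsmall : 6 * 3 ^ α * M * ε ≤ α * m)
    (hN : HasFDerivAt N N' x) (hN1 : ε ≤ N x) (hN3 : N x ≤ 3 * ε)
    (hN' : ∀ i : Fin 2, |N' (EuclideanSpace.single i 1)| ≤ 1)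
    (hN0 : N' (EuclideanSpace.single 0 1) ≤ -(1 / 3))
    (hd : DifferentiableAt ℝ h₁ x) (hmx : m ≤ h₁ x) (hMx : h₁ x ≤ M)
    (hMd : ∀ v, |fderiv ℝ h₁ x v| ≤ M * ‖v‖)
    (heq : h₀ =ᶠ[𝓝 x] fun y => N y ^ α * h₁ y) :
    0 ≤ h₀ x ∧ h₀ x ≤ (α + 1) * 3 ^ α * M * ε ^ α ∧
      (∀ i : Fin 2, |fderiv ℝ h₀ x (EuclideanSpace.single i 1)| ≤
        (α + 1) * 3 ^ α * M * ε ^ α / ε) ∧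
      fderiv ℝ h₀ x (EuclideanSpace.single 0 1) ≤ -(α * m / 6 * ε ^ α / ε) := by
  have hNpos : 0 < N x := hε.trans_le hN1
  have hα0 : 0 < α := one_pos.trans hα
  have hεα : 0 < ε ^ α := Real.rpow_pos_of_pos hε α
  have h3 : (0 : ℝ) < 3 ^ α := Real.rpow_pos_of_pos three_pos α
  have hup : N x ^ α ≤ 3 ^ α * ε ^ α := by
    rw [← Real.mul_rpow three_pos.le hε.le]
    exact Real.rpow_le_rpow hNpos.le hN3 hα0.le
  have hNα : 0 < N x ^ α := Real.rpow_pos_of_pos hNpos α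
  have hε1' : ε ^ (α - 1) = ε ^ α / ε := Real.rpow_sub_one hε.ne' α
  have hlow1 : ε ^ α / ε ≤ N x ^ (α - 1) := by
    rw [← hε1']
    exact Real.rpow_le_rpow hε.le hN1 (by linarith)
  have hup1 : N x ^ (α - 1) ≤ 3 ^ α * (ε ^ α / ε) := by
    calc N x ^ (α - 1) ≤ (3 * ε) ^ (α - 1) := Real.rpow_le_rpow hNpos.le hN3 (by linarith)
      _ = 3 ^ (α - 1) * (ε ^ α / ε) := by rw [Real.mul_rpow three_pos.le hε.le, hε1']
      _ ≤ 3 ^ α * (ε ^ α / ε) := by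
        refine mul_le_mul_of_nonneg_right ?_ (by positivity)
        exact Real.rpow_le_rpow_of_exponent_le (by norm_num) (by linarith)
  have hh1 : 0 < h₁ x := hm.trans_le hmx
  have hfd : ∀ v, fderiv ℝ h₀ x v =
      α * N x ^ (α - 1) * N' v * h₁ x + N x ^ α * fderiv ℝ h₁ x v := by
    intro v
    have h := ((hN.rpow_const (p := α) (Or.inl hNpos.ne')).mul hd.hasFDerivAt).fderiv
    rw [heq.fderiv_eq]
    refine (congrArg (fun l : Plane →L[ℝ] ℝ => l v) h).trans ?_
    simp
    ring
  -- Since `ε ≤ 1`, the term differentiating `h₁` can be bounded at the same scale as the leading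
  -- one.
  have hself : ε ^ α ≤ ε ^ α / ε := le_div_self hεα.le hε hε1
  have hnorm : ∀ i : Fin 2, ‖(EuclideanSpace.single i 1 : Plane)‖ = 1 := fun i => by simp
  have hsecond : ∀ i : Fin 2, |N x ^ α * fderiv ℝ h₁ x (EuclideanSpace.single i 1)| ≤
      3 ^ α * ε ^ α * M := fun i => by
    rw [abs_mul, abs_of_pos hNα]
    refine mul_le_mul hup ?_ (abs_nonneg _) (by positivity)
    simpa [hnorm i] using hMd (EuclideanSpace.single i 1)
  have hx0 : h₀ x = N x ^ α * h₁ x := heq.self_of_nhds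
  refine ⟨by rw [hx0]; positivity, ?_, fun i => ?_, ?_⟩
  · rw [hx0]
    calc N x ^ α * h₁ x ≤ 3 ^ α * ε ^ α * M := mul_le_mul hup hMx hh1.le (by positivity)
      _ ≤ (α + 1) * (3 ^ α * ε ^ α * M) := le_mul_of_one_le_left (by positivity) (by linarith)
      _ = (α + 1) * 3 ^ α * M * ε ^ α := by ring
  · rw [hfd]
    have h1 : |α * N x ^ (α - 1) * N' (EuclideanSpace.single i 1) * h₁ x| ≤
        α * (3 ^ α * (ε ^ α / ε)) * 1 * M := by
      rw [abs_mul, abs_mul, abs_mul, abs_of_pos hα0, abs_of_pos hh1,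
        abs_of_pos (Real.rpow_pos_of_pos hNpos (α - 1))]
      gcongr
      exact hN' i
    have h2 : 3 ^ α * ε ^ α * M ≤ 3 ^ α * (ε ^ α / ε) * M := by gcongr
    refine (abs_add_le _ _).trans ((add_le_add h1 ((hsecond i).trans h2)).trans (le_of_eq ?_))
    ring
  · rw [hfd]
    have h1 : α * N x ^ (α - 1) * N' (EuclideanSpace.single 0 1) * h₁ x ≤
        -(α * (ε ^ α / ε) * m / 3) := by
      have h4 : α * (ε ^ α / ε) * m ≤ α * N x ^ (α - 1) * h₁ x := by gcongr
      have h5 : 0 < α * N x ^ (α - 1) * h₁ x := by positivity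
      nlinarith
    have h2 := (le_abs_self _).trans (hsecond 0)
    -- The term with the derivative of `h₁` is smaller by a factor `ε`; `hsmall` makes it at most
    -- half of the leading `α * m / 3`, which leaves `α * m / 6`.
    have h6 : 3 ^ α * ε ^ α * M ≤ α * m / 6 * (ε ^ α / ε) := by
      have h7 := mul_le_mul_of_nonneg_right hsmall (by positivity : 0 ≤ ε ^ α / ε)
      have h8 : 6 * 3 ^ α * M * ε * (ε ^ α / ε) = 6 * (3 ^ α * ε ^ α * M) := by
        field_simp
      rw [h8] at h7
      linarith
    have h9 : α * m / 6 * ε ^ α / ε = α * m / 6 * (ε ^ α / ε) := by ring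
    rw [h9]
    linarith

theorem hasFDerivAt_abs_coord {x : Plane} (hx : x 0 < 0) :
    HasFDerivAt (fun y : Plane => |y 0|) (-(EuclideanSpace.proj 0 : Plane →L[ℝ] ℝ)) x := by
  have h0 : HasFDerivAt (fun y : Plane => y 0) (EuclideanSpace.proj 0 : Plane →L[ℝ] ℝ) x :=
    (EuclideanSpace.proj 0 : Plane →L[ℝ] ℝ).hasFDerivAt
  have h := (hasDerivAt_abs_neg hx).comp_hasFDerivAt x h0
  rwa [neg_one_smul] at h

/-- Differentiate the norm as the square root of its square, which is nonzero at `x`. -/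
theorem hasFDerivAt_norm_of_ne {x : Plane} (hx : x ≠ 0) :
    HasFDerivAt (fun y : Plane => ‖y‖) (‖x‖⁻¹ • innerSL ℝ x) x := by
  have hx' : ‖x‖ ≠ 0 := norm_ne_zero_iff.2 hx
  have h := (hasStrictFDerivAt_norm_sq x).hasFDerivAt.sqrt (pow_ne_zero 2 hx')
  simp only [Real.sqrt_sq (norm_nonneg _)] at h
  refine h.congr_fderiv ?_
  ext v
  simp
  field_simp

end ContactEstimates

/-! ### Blow-up of the load for both kinds of contact -/

section LoadBlowUp

open Filter Topology

variable {Ω : Opens Plane} {h₀ : Plane → ℝ}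

/-- The common core of the two cases: `N` is the distance to the contact set, `δ` the half-length of
the box, and `hlim` the only place where the geometry limits `α` beyond `α > 1`. -/
theorem exists_load_gt (hbdd : Bornology.IsBounded (Ω : Set Plane))
    (hC1 : IsC1UpToBoundary Ω h₀) (hnn : ∀ x ∈ Ω, 0 ≤ h₀ x) {α : ℝ} (hα : 1 < α)
    {W : Opens Plane} {h₁ N : Plane → ℝ} {δ : ℝ → ℝ} {r m M : ℝ} (hWΩ : W ≤ Ω)
    (hh₁ : ContDiffOn ℝ 1 h₁ (W : Set Plane)) (hN : ∀ x ∈ W, h₀ x = N x ^ α * h₁ x)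
    (hm : 0 < m) (hM : 0 < M) (hball : ∀ x : Plane, ‖x‖ ≤ r → x ∈ W ∧ m ≤ h₁ x ∧ h₁ x ≤ M ∧
      ∀ v, |fderiv ℝ h₁ x v| ≤ M * ‖v‖)
    (hδ : ∀ᶠ ε in 𝓝[>] (0 : ℝ), ε ≤ δ ε ∧ 2 * ε + δ ε ≤ r)
    (hbox : ∀ ε > 0, ∀ x ∈ contactBox ε (δ ε), ∃ N' : Plane →L[ℝ] ℝ, HasFDerivAt N N' x ∧
      ε ≤ N x ∧ N x ≤ 3 * ε ∧ (∀ i : Fin 2, |N' (EuclideanSpace.single i 1)| ≤ 1) ∧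
      N' (EuclideanSpace.single 0 1) ≤ -(1 / 3))
    (hlim : Tendsto (fun ε => δ ε * ε ^ 2 / (ε ^ α) ^ 2) (𝓝[>] 0) atTop) (F : ℝ) :
    ∃ β : ℝ, 0 < β ∧ F < ∫ x in (Ω : Set Plane), (reynoldsPressure Ω h₀ β 0).fst x := by
  obtain ⟨κ, hκ, hload⟩ := exists_load_constant
  have hα0 : 0 < α := one_pos.trans hα
  have h3 : (0 : ℝ) < 3 ^ α := Real.rpow_pos_of_pos three_pos α
  set P : ℝ := (α + 1) * 3 ^ α * M with hP
  have hP0 : 0 < P := by positivity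
  have hc : 0 < κ * (α * m / 6 / (P + 1) ^ 3) := by positivity
  have e1 : ∀ᶠ ε in 𝓝[>] (0 : ℝ), ε < 1 :=
    mem_nhdsWithin_of_mem_nhds (gt_mem_nhds one_pos)
  have e2 : ∀ᶠ ε in 𝓝[>] (0 : ℝ), ε < α * m / (6 * 3 ^ α * M) :=
    mem_nhdsWithin_of_mem_nhds (gt_mem_nhds (by positivity))
  have e3 := (hlim.const_mul_atTop hc).eventually_gt_atTop F
  have e4 : ∀ᶠ ε in 𝓝[>] (0 : ℝ), 0 < ε := self_mem_nhdsWithin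
  obtain ⟨ε, ⟨hε1, hε2⟩, hF, hε, hεδ, hεr⟩ :=
    ((e1.and e2).and (e3.and (e4.and hδ))).exists
  have hεα : 0 < ε ^ α := Real.rpow_pos_of_pos hε α
  have hin : ∀ x ∈ contactBox ε (δ ε), ‖x‖ ≤ r := fun x hx =>
    (norm_le_of_mem_contactBox hε.le hx).trans hεr
  -- Taking `β = ε ^ α` matches `β` to the size of `h₀` on the box.
  refine ⟨ε ^ α, hεα, hF.trans_le (hload Ω h₀ hbdd hC1 P (α * m / 6) ε (δ ε) (ε ^ α) hP0.le hε hεδ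
    hεα (fun x hx => hWΩ (hball x (hin x hx)).1) (fun x hx => ?_) _
    (isReynoldsSolution_reynoldsPressure hbdd hC1 hnn 0 hεα))⟩
  obtain ⟨hxW, hmx, hMx, hMd⟩ := hball x (hin x hx)
  obtain ⟨N', hN', hN1, hN3, hNi, hN0⟩ := hbox ε hε x hx
  refine rpow_mul_estimates hα hε hε1.le hm hM ?_ hN' hN1 hN3 hNi hN0
    ((hh₁.contDiffAt (W.isOpen.mem_nhds hxW)).differentiableAt one_ne_zero) hmx hMx hMd ?_
  · rw [lt_div_iff₀ (by positivity)] at hε2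
    linarith
  · filter_upwards [W.isOpen.mem_nhds hxW] with y hy using hN y hy

theorem exists_load_gt_of_isLineContact (hbdd : Bornology.IsBounded (Ω : Set Plane))
    (hC1 : IsC1UpToBoundary Ω h₀) (hnn : ∀ x ∈ Ω, 0 ≤ h₀ x) {α : ℝ} (hα : 1 < α)
    (h : IsLineContact Ω h₀ α) (F : ℝ) :
    ∃ β : ℝ, 0 < β ∧ F < ∫ x in (Ω : Set Plane), (reynoldsPressure Ω h₀ β 0).fst x := by
  obtain ⟨-, -, W, h₁, h0W, hWΩ, hh₁, hpos, heq⟩ := h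
  obtain ⟨r, m, M, hr, hm, hM, hball⟩ := exists_bounds_of_contDiffOn h0W hh₁ hpos
  -- `|x 0|` does not depend on `x 1`, so the box may keep a fixed length.
  refine exists_load_gt hbdd hC1 hnn hα (N := fun x => |x 0|) (δ := fun _ => r / 2) hWΩ hh₁ heq
    hm hM hball ?_ ?_ ?_ F
  · have e1 : ∀ᶠ ε in 𝓝[>] (0 : ℝ), ε < r / 4 :=
      mem_nhdsWithin_of_mem_nhds (gt_mem_nhds (by positivity))
    filter_upwards [e1] with ε hε
    constructor <;> linarith
  · rintro ε hε x ⟨h1, h2, -⟩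
    have hx : x 0 < 0 := by linarith
    refine ⟨_, hasFDerivAt_abs_coord hx, ?_, ?_, fun i => ?_, ?_⟩
    · rw [abs_of_neg hx]; linarith
    · rw [abs_of_neg hx]; linarith
    · fin_cases i <;> simp
    · simp; norm_num
  · have h1 := (tendsto_rpow_neg_nhdsGT_zero (by linarith : 2 - 2 * α < 0)).const_mul_atTop
      (by positivity : 0 < r / 2)
    refine h1.congr' ?_
    filter_upwards [self_mem_nhdsWithin] with ε hε
    have hε' : (0 : ℝ) < ε := hε
    rw [Real.rpow_sub hε', mul_comm 2 α, Real.rpow_mul hε'.le, Real.rpow_two, Real.rpow_two,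
      mul_div_assoc]

theorem exists_load_gt_of_isPointContact (hbdd : Bornology.IsBounded (Ω : Set Plane))
    (hC1 : IsC1UpToBoundary Ω h₀) (hnn : ∀ x ∈ Ω, 0 ≤ h₀ x) {α : ℝ} (hα : 3 / 2 < α)
    (h : IsPointContact Ω h₀ α) (F : ℝ) :
    ∃ β : ℝ, 0 < β ∧ F < ∫ x in (Ω : Set Plane), (reynoldsPressure Ω h₀ β 0).fst x := by
  obtain ⟨-, -, W, h₁, h0W, hWΩ, hh₁, hpos, heq⟩ := h
  obtain ⟨r, m, M, hr, hm, hM, hball⟩ := exists_bounds_of_contDiffOn h0W hh₁ hpos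
  -- Here `‖x‖` must stay comparable to `ε` on the box, which forces its length to be of order `ε`.
  refine exists_load_gt hbdd hC1 hnn (by linarith) (N := fun x => ‖x‖) (δ := id) hWΩ hh₁ heq
    hm hM hball ?_ ?_ ?_ F
  · have e1 : ∀ᶠ ε in 𝓝[>] (0 : ℝ), ε < r / 3 :=
      mem_nhdsWithin_of_mem_nhds (gt_mem_nhds (by positivity))
    filter_upwards [e1] with ε hε
    exact ⟨le_rfl, by simp only [id]; linarith⟩
  · intro ε hε x hx
    have h1 := norm_le_of_mem_contactBox hε.le hx
    simp only [id] at h1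
    have h2 := hx.2.1
    have h3 : |x 0| ≤ ‖x‖ := PiLp.norm_apply_le x 0
    have h4 : ε ≤ ‖x‖ := by linarith [neg_le_abs (x 0)]
    have hpos : 0 < ‖x‖ := lt_of_lt_of_le hε h4
    refine ⟨_, hasFDerivAt_norm_of_ne (norm_pos_iff.1 hpos), h4, by linarith, fun i => ?_, ?_⟩
    · have h5 : |x i| ≤ ‖x‖ := PiLp.norm_apply_le x i
      have e : (‖x‖⁻¹ • innerSL ℝ x) (EuclideanSpace.single i 1) = x i / ‖x‖ := by
        simp [EuclideanSpace.inner_single_right, div_eq_inv_mul]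
      rw [e, abs_div, abs_norm]
      exact (div_le_one hpos).2 h5
    · have e : (‖x‖⁻¹ • innerSL ℝ x) (EuclideanSpace.single 0 1) = x 0 / ‖x‖ := by
        simp [EuclideanSpace.inner_single_right, div_eq_inv_mul]
      -- The slope `-1/3` comes from `x 0 ≤ -ε` and `‖x‖ ≤ 3 * ε`.
      rw [e, div_le_iff₀ hpos]
      linarith
  · refine (tendsto_rpow_neg_nhdsGT_zero (by linarith : 3 - 2 * α < 0)).congr' ?_
    filter_upwards [self_mem_nhdsWithin] with ε hε
    have hε' : (0 : ℝ) < ε := hε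
    have h3 : ε ^ (3 : ℝ) = id ε * ε ^ 2 := by
      rw [show (3 : ℝ) = ((3 : ℕ) : ℝ) by norm_num, Real.rpow_natCast, id]; ring
    rw [Real.rpow_sub hε', mul_comm 2 α, Real.rpow_mul hε'.le, Real.rpow_two, h3]

end LoadBlowUp

/-! ### The stationary solution by the intermediate value theorem -/

theorem theorem2 (Ω : Opens Plane) (hbdd : Bornology.IsBounded (Ω : Set Plane))
    (h0mem : (0 : Plane) ∈ Ω) (h₀ : Plane → ℝ) (hC1 : IsC1UpToBoundary Ω h₀)
    (hnonneg : ∀ x ∈ Ω, 0 ≤ h₀ x) (hzero : h₀ 0 = 0) (F : ℝ) (hF : 0 < F) (α : ℝ)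
    (hcase : (IsLineContact Ω h₀ α ∧ 1 < α) ∨ (IsPointContact Ω h₀ α ∧ 3 / 2 < α)) :
    (∀ β γ : ℝ, 0 < β → ∃! q : L2Pair Ω, IsReynoldsSolution Ω h₀ β γ q) ∧
      ∃ η : ℝ, 0 < η ∧ reynoldsG Ω h₀ F η 0 = 0 := by
  refine ⟨fun β γ hβ => existsUnique_isReynoldsSolution hbdd hC1 hnonneg γ hβ, ?_⟩
  obtain ⟨β₁, hβ₁, hlarge⟩ : ∃ β : ℝ, 0 < β ∧
      F < ∫ x in (Ω : Set Plane), (reynoldsPressure Ω h₀ β 0).fst x := by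
    rcases hcase with ⟨h, hα⟩ | ⟨h, hα⟩
    · exact exists_load_gt_of_isLineContact hbdd hC1 hnonneg hα h F
    · exact exists_load_gt_of_isPointContact hbdd hC1 hnonneg hα h F
  obtain ⟨β₂, hsmall, hβ₂⟩ :=
    (((tendsto_reynoldsG_atTop hbdd hC1 hnonneg F 0).eventually_lt_const
      (neg_lt_zero.2 hF)).and (Filter.eventually_gt_atTop 0)).exists
  -- Connectedness of `(0, ∞)` suffices, so `β₁` and `β₂` need not be ordered.
  obtain ⟨η, hη, hη0⟩ := isPreconnected_Ioi.intermediate_value (Set.mem_Ioi.2 hβ₂)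
    (Set.mem_Ioi.2 hβ₁) (continuousOn_reynoldsG hbdd hC1 hnonneg F 0)
    ⟨hsmall.le, (sub_pos.2 hlarge).le⟩
  exact ⟨η, hη, hη0⟩
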